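/- Let $\mathcal X$ be a separable topological space with its Borel $\sigma$-field, $K:\mathcal X\times\mathcal X\to\mathbb R$ a continuous reproducing kernel with reproducing kernel Hilbert space $H$, and $P$ a Borel probability measure on $\mathcal X$ with $\int K(x,x)\,dP(x)<\infty$. Write $\mu_P=\int K(\cdot,x)\,dP(x)\in H$ for its mean embedding and $\Sigma_P=\int (K(\cdot,x)-\mu_P)\otimes(K(\cdot,x)-\mu_P)\,dP(x)$ for its covariance operator on $H$ (Bochner integrals, $(a\otimes b)c=a\langle b,c\rangle$), and assume that $\Sigma_P$ is trace-class; $\|\Sigma_P\|$ is its operator norm and $\operatorname{Tr}\Sigma_P$ its trace. Let $x_1,\dots,x_N$ be i.i.d. with law $P$, and let the observed sample $y_1,\dots,y_N$ be obtained from it by corrupting at most $N_c$ of its elements arbitrarily (which elements are corrupted, and how, may depend on the whole sample). Let $\delta\in(0,1/2]$ and $\eta\in(0,1)$ be such that $Q:=72\,\delta^{-2}\ln(1/\eta)$ is a positive integer dividing $N$ with $N_c\le Q(1/2-\delta)$ and $Q<N/2$, and let $S_1,\dots,S_Q$ be a fixed partition of $\{1,\dots,N\}$ into blocks of cardinality $N/Q$.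 For $f,g\in H$ put $$\tilde J(f,g)=\operatorname*{median}_{1\le q\le Q}\ \frac1{|S_q|}\sum_{n\in S_q}\left(\|f-K(\cdot,y_n)\|_H^2-\|g-K(\cdot,y_n)\|_H^2\right),$$ where the median of an even number of values is the midpoint of the two middle ones. Then, with probability at least $1-\eta$, every minmax median-of-means estimator $\hat\mu_{P,Q}\in\arg\min_{f\in H}\sup_{g\in H}\tilde J(f,g)$ satisfies $$\|\hat\mu_{P,Q}-\mu_P\|_H\le\frac{12(1+\sqrt2)}{\delta}\max\left(\sqrt{\frac{6\|\Sigma_P\|\ln(1/\eta)}{\delta N}},\ 2\sqrt{\frac{\operatorname{Tr}\Sigma_P}{N}}\right).$$ -/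

import Mathlib

open MeasureTheory ProbabilityTheory InnerProductSpace

namespace Monk

noncomputable section

/-- The median of finitely many real numbers `z 0, …, z (Q - 1)`: after sorting in increasing
order, the middle value if `Q` is odd and the midpoint of the two middle values if `Q` is even.
(The median of the empty family is set to `0`.) -/
def median {Q : ℕ} (z : Fin Q → ℝ) : ℝ :=
  if h : 0 < Q then
    (z (Tuple.sort z ⟨(Q - 1) / 2, by omega⟩) + z (Tuple.sort z ⟨Q / 2, by omega⟩)) / 2
  else 0

/-- `S` is a partition of the `N` indices into `Q` blocks, all having `N / Q` elements. -/
structure IsBlockPartition {N Q : ℕ} (S : Fin Q → Finset (Fin N)) : Prop where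
  disjoint : ∀ p q, p ≠ q → Disjoint (S p) (S q)
  cover : ∀ n, ∃ q, n ∈ S q
  card_mul : ∀ q, (S q).card * Q = N

/-- The mean of `h` over the block `B` of the data set `y`. -/
def blockMean {N : ℕ} {X : Type*} (y : Fin N → X) (B : Finset (Fin N)) (h : X → ℝ) : ℝ :=
  (B.card : ℝ)⁻¹ * ∑ n ∈ B, h (y n)

/-- The median-of-means of `h` on the data set `y` with blocks `S`. -/
def mom {N Q : ℕ} {X : Type*} (S : Fin Q → Finset (Fin N)) (y : Fin N → X) (h : X → ℝ) : ℝ :=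
  median fun q => blockMean y (S q) h

section RKHSDefs

variable {X : Type*} (H : Type*) [NormedAddCommGroup H] [InnerProductSpace ℝ H] [CompleteSpace H]
  [RKHS ℝ H X ℝ]

/-- The canonical feature `K(·, x)`, as an element of the reproducing kernel Hilbert space `H`. -/
def feature (x : X) : H := RKHS.kerFun H x 1

/-- The mean embedding `∫ K(·, x) dP(x)` (a Bochner integral in `H`). -/
def meanEmbedding [MeasurableSpace X] (P : Measure X) : H := ∫ x, feature H x ∂P

/-- The covariance operator `∫ (K(·, x) - μ_P) ⊗ (K(·, x) - μ_P) dP(x)` (a Bochner integral of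
rank-one operators), where `(a ⊗ b) c = ⟪b, c⟫ a`. -/
def covOp [MeasurableSpace X] (P : Measure X) : H →L[ℝ] H :=
  ∫ x, rankOne ℝ (feature H x - meanEmbedding H P) (feature H x - meanEmbedding H P) ∂P

variable {H}

/-- The minmax criterion: the median-of-means of
`x ↦ ‖f - K(·, x)‖ ^ 2 - ‖g - K(·, x)‖ ^ 2`. -/
def criterion {N Q : ℕ} (S : Fin Q → Finset (Fin N)) (y : Fin N → X) (f g : H) : ℝ :=
  mom S y fun x => ‖f - feature H x‖ ^ 2 - ‖g - feature H x‖ ^ 2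

variable (H) in
/-- The set of minmax median-of-means estimators computed from the data set `y`: the minimisers
over `f` of the supremum over `g` (taken in the extended reals) of the criterion. -/
def estimators {N Q : ℕ} (S : Fin Q → Finset (Fin N)) (y : Fin N → X) : Set H :=
  {f | IsMinOn (fun f' : H => ⨆ g : H, ((criterion S y f' g : ℝ) : EReal)) Set.univ f}

end RKHSDefs

section TraceDefs

variable {H : Type*} [NormedAddCommGroup H] [InnerProductSpace ℝ H] {ι : Type*}

/-- The trace of `A`, computed in the orthonormal basis `e`. -/
def opTrace (e : HilbertBasis ι ℝ H) (A : H →L[ℝ] H) : ℝ := ∑' i, inner ℝ (A (e i)) (e i)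

/-- `A` is trace-class: its absolute value `R = (A* A)^{1/2}`, the positive square root of `A* A`,
satisfies `∑ i, ⟪R (e i), e i⟫ < ∞` (in the orthonormal basis `e`). -/
def IsTraceClass [CompleteSpace H] (e : HilbertBasis ι ℝ H) (A : H →L[ℝ] H) : Prop :=
  ∃ R : H →L[ℝ] H, R.IsPositive ∧ R ∘L R = ContinuousLinearMap.adjoint A ∘L A ∧
    Summable fun i => inner ℝ (R (e i)) (e i)

end TraceDefs

section WellDefined

lemma median_sub_mul {Q : ℕ} (hQ : 0 < Q) (z : Fin Q → ℝ) (c : ℝ) :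
    median (fun q => c - 2 * z q) = c - 2 * median z := by
  have key : (fun q => c - 2 * z q) ∘ Tuple.sort (fun q => c - 2 * z q) =
      (fun q => c - 2 * z q) ∘ (Fin.revPerm.trans (Tuple.sort z)) := by
    apply Tuple.unique_monotone (Tuple.monotone_sort _)
    intro i j hij
    have := Tuple.monotone_sort z (Fin.rev_le_rev.mpr hij)
    simp only [Function.comp, Equiv.trans_apply, Fin.revPerm_apply] at this ⊢
    linarith
  have k1 := congrFun key ⟨(Q - 1) / 2, by omega⟩
  have k2 := congrFun key ⟨Q / 2, by omega⟩
  have r1 : Fin.rev (⟨(Q - 1) / 2, by omega⟩ : Fin Q) = ⟨Q / 2, by omega⟩ := by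
    ext; simp; omega
  have r2 : Fin.rev (⟨Q / 2, by omega⟩ : Fin Q) = ⟨(Q - 1) / 2, by omega⟩ := by
    ext; simp; omega
  simp only [Function.comp, Equiv.trans_apply, Fin.revPerm_apply, r1, r2] at k1 k2
  rw [median, dif_pos hQ, k1, k2, median, dif_pos hQ]
  ring

lemma abs_median_le {Q : ℕ} (hQ : 0 < Q) (z : Fin Q → ℝ) (M : ℝ) (h : ∀ q, |z q| ≤ M) :
    |median z| ≤ M := by
  rw [median, dif_pos hQ]
  have h1 := abs_le.mp (h (Tuple.sort z ⟨(Q - 1) / 2, by omega⟩))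
  have h2 := abs_le.mp (h (Tuple.sort z ⟨Q / 2, by omega⟩))
  rw [abs_le]; constructor <;> linarith [h1.1, h1.2, h2.1, h2.2]

variable {X : Type*} {H : Type*} [NormedAddCommGroup H] [InnerProductSpace ℝ H] [CompleteSpace H]
  [RKHS ℝ H X ℝ]

lemma criterion_eq {N Q : ℕ} (hQ : 0 < Q) (S : Fin Q → Finset (Fin N)) (hS : ∀ q, (S q).Nonempty)
    (y : Fin N → X) (f g : H) :
    criterion S y f g = 2 * inner ℝ f (f - g) - ‖f - g‖ ^ 2 - 2 * median fun q =>
      inner ℝ (((S q).card : ℝ)⁻¹ • ∑ n ∈ S q, feature H (y n)) (f - g) := by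
  rw [← median_sub_mul hQ, criterion, mom]
  congr 1
  ext q
  have hc : ((S q).card : ℝ) ≠ 0 := by exact_mod_cast (hS q).card_pos.ne'
  have : ∀ n, ‖f - feature H (y n)‖ ^ 2 - ‖g - feature H (y n)‖ ^ 2 =
      (2 * inner ℝ f (f - g) - ‖f - g‖ ^ 2) - 2 * inner ℝ (feature H (y n)) (f - g) := by
    intro n
    rw [norm_sub_sq_real, norm_sub_sq_real, norm_sub_sq_real, inner_sub_right, inner_sub_right,
      real_inner_self_eq_norm_sq, real_inner_comm f (feature H (y n)),
      real_inner_comm g (feature H (y n))]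
    ring
  simp only [blockMean, this, Finset.sum_sub_distrib, Finset.sum_const, nsmul_eq_mul,
    inner_smul_left, sum_inner, ← Finset.mul_sum]
  simp only [conj_trivial]
  field_simp

/-- The minimum in the definition of the estimator is attained, for every data set. -/
theorem estimators_nonempty {N Q : ℕ} (S : Fin Q → Finset (Fin N)) (hS : ∀ q, (S q).Nonempty)
    (y : Fin N → X) : (estimators H S y).Nonempty := by
  rcases Nat.eq_zero_or_pos Q with h0 | hQ
  · exact ⟨0, by simp [estimators, criterion, mom, median, h0, isMinOn_const]⟩
  set a : Fin Q → H := fun q => ((S q).card : ℝ)⁻¹ • ∑ n ∈ S q, feature H (y n) with ha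
  set G : H → EReal := fun f => ⨆ h : H,
    ((2 * inner ℝ f h - ‖h‖ ^ 2 - 2 * median (fun q => inner ℝ (a q) h) : ℝ) : EReal) with hG
  have hE : (fun f : H => ⨆ g : H, ((criterion S y f g : ℝ) : EReal)) = G := by
    ext f
    simp only [criterion_eq hQ S hS, hG]
    exact (Equiv.subLeft f).iSup_congr fun g => rfl
  let V : Submodule ℝ H := Submodule.span ℝ (Set.range a)
  have : FiniteDimensional ℝ V := FiniteDimensional.span_of_finite ℝ (Set.finite_range a)
  have haV : ∀ q, a q ∈ V := fun q => Submodule.subset_span ⟨q, rfl⟩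
  set M : ℝ := ∑ q, ‖a q‖ with hM
  have hM0 : 0 ≤ M := Finset.sum_nonneg fun _ _ => norm_nonneg _
  have hmed : ∀ h : H, |median fun q => inner ℝ (a q) h| ≤ M * ‖h‖ := fun h =>
    abs_median_le hQ _ _ fun q => (abs_real_inner_le_norm _ _).trans
      (mul_le_mul_of_nonneg_right
        (Finset.single_le_sum (f := fun q => ‖a q‖) (fun _ _ => norm_nonneg _) (Finset.mem_univ q))
        (norm_nonneg h))
  have hG0 : G 0 ≤ ((M ^ 2 : ℝ) : EReal) := by
    refine iSup_le fun h => EReal.coe_le_coe_iff.mpr ?_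
    have := (abs_le.mp (hmed h)).1
    simp only [inner_zero_left]
    nlinarith [sq_nonneg (‖h‖ - M)]
  have hGf : ∀ f : H, ((‖f‖ ^ 2 - 2 * M * ‖f‖ : ℝ) : EReal) ≤ G f := fun f => by
    refine le_iSup_of_le f (EReal.coe_le_coe_iff.mpr ?_)
    have := (abs_le.mp (hmed f)).2
    rw [real_inner_self_eq_norm_sq]
    nlinarith
  have hlsc : LowerSemicontinuous fun v : V => G v := by
    refine lowerSemicontinuous_iSup fun h => Continuous.lowerSemicontinuous ?_
    refine continuous_coe_real_ereal.comp ?_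
    fun_prop
  obtain ⟨v, hv, hmin⟩ := (hlsc.lowerSemicontinuousOn (Metric.closedBall 0 (3 * M))).exists_isMinOn
    ⟨0, by simp [hM0]⟩ (isCompact_closedBall _ _)
  have hminV : ∀ w : V, G v ≤ G w := by
    intro w
    by_cases hw : w ∈ Metric.closedBall (0 : V) (3 * M)
    · exact hmin hw
    · have h1 : G v ≤ G (0 : V) := hmin (by simp [hM0])
      refine (h1.trans hG0).trans (le_trans (EReal.coe_le_coe_iff.mpr ?_) (hGf w))
      have : 3 * M < ‖(w : H)‖ := by simpa using hw
      nlinarith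
  have hproj : ∀ f : H, G (V.starProjection f) ≤ G f := by
    intro f
    refine iSup_le fun h => le_iSup_of_le (V.starProjection h) (EReal.coe_le_coe_iff.mpr ?_)
    have h1 : inner ℝ (V.starProjection f) h = inner ℝ f (V.starProjection h) :=
      V.inner_starProjection_left_eq_right f h
    have h2 : ∀ q, inner ℝ (a q) h = inner ℝ (a q) (V.starProjection h) := fun q => by
      rw [← V.inner_starProjection_left_eq_right,
        Submodule.starProjection_eq_self_iff.mpr (haV q)]
    simp only [h1, h2]
    nlinarith [V.norm_starProjection_apply_le h, norm_nonneg (V.starProjection h)]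
  refine ⟨v, ?_⟩
  rw [estimators, hE]
  exact fun f _ => (hminV (V.orthogonalProjectionOnto f)).trans (hproj f)

end WellDefined

end

end Monk

/-! Let μ be the mean embedding and Z_q the average over block q of the features centred at μ.
Expanding squares, the criterion at (f, g) is 2⟪f − μ, f − g⟫ − ‖f − g‖² minus twice the median over
q of ⟪f − g, Z_q⟫. Suppose this median is at most r‖h‖ in absolute value in every direction h. Then
the criterion at f = μ never exceeds r², a minimiser f does no worse against g = μ, and t = ‖f − μ‖
satisfies t² − 2rt ≤ r², so t ≤ (1 + √2) r (`norm_sub_le_of_mem_estimators`).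

The median is controlled as soon as fewer than half of the blocks are large in direction h.
Corruption spoils at most Q(1/2 − δ) blocks, so it suffices that fewer than δQ clean blocks are
large, simultaneously for all h (`exists_measurableSet_forall_card_lt`). The indicator of a large
block is dominated by a Lipschitz bump, whose sum over the blocks splits into three contributions:
the mean, at most δQ/3 by Chebyshev and the operator norm of the covariance; the expected supremum
of the centred sum, at most δQ/6 by symmetrisation, contraction and the trace
(`integral_ciSup_sum_le`); and a deviation δQ/12, exceeded with probability at most exp(−Qδ²/72) = η
by McDiarmid. The total 7δQ/12 is below δQ. The two entries of the maximum in the final bound are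
what the first two contributions require of r. -/

namespace Monk

/-! ### Splitting off one coordinate of a finite product measure -/

section Product

variable {n : ℕ} {Z : Type*} [MeasurableSpace Z] (ν : Fin (n + 1) → Measure Z)
  [∀ i, IsProbabilityMeasure (ν i)]

lemma measurePreserving_cons :
    MeasurePreserving (fun p : Z × (Fin n → Z) => (Fin.cons p.1 p.2 : Fin (n + 1) → Z))
      ((ν 0).prod (Measure.pi fun j => ν j.succ)) (Measure.pi ν) := by
  have h := (measurePreserving_piFinSuccAbove ν 0).symm
  simp only [Fin.succAbove_zero] at h
  convert h using 1
  ext p i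
  simp [MeasurableEquiv.piFinSuccAbove_symm_apply, Fin.insertNthEquiv]

lemma integral_pi_cons {F : (Fin (n + 1) → Z) → ℝ} (hF : AEStronglyMeasurable F (Measure.pi ν)) :
    ∫ z, F z ∂Measure.pi ν =
      ∫ p : Z × (Fin n → Z), F (Fin.cons p.1 p.2) ∂(ν 0).prod (Measure.pi fun j => ν j.succ) := by
  have h := measurePreserving_cons ν
  rw [← h.map_eq] at hF ⊢
  exact integral_map h.measurable.aemeasurable hF

end Product

/-! ### McDiarmid's inequality -/

section BoundedDifferences

variable {Z : Type*} [MeasurableSpace Z]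

/-- A form of Hoeffding's lemma for functions of oscillation at most one. -/
lemma integral_exp_mul_le_of_abs_sub_le_one (ν : Measure Z) [IsProbabilityMeasure ν] {g : Z → ℝ}
    (hg : Measurable g) (hosc : ∀ a b, |g a - g b| ≤ 1) (l : ℝ) :
    ∫ z, Real.exp (l * g z) ∂ν ≤ Real.exp (l * ∫ z, g z ∂ν + l ^ 2 / 8) := by
  have : Nonempty Z := nonempty_of_isProbabilityMeasure ν
  obtain ⟨z₀⟩ := this
  have hb : BddBelow (Set.range g) := ⟨g z₀ - 1, by
    rintro _ ⟨z, rfl⟩; have := (abs_le.mp (hosc z z₀)).1; linarith⟩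
  have hIcc : ∀ z, g z ∈ Set.Icc (⨅ z, g z) ((⨅ z, g z) + 1) := fun z => by
    have : Nonempty Z := ⟨z₀⟩
    refine ⟨ciInf_le hb z, ?_⟩
    have : g z - 1 ≤ ⨅ z, g z := le_ciInf fun b => by
      have := (abs_le.mp (hosc z b)).2; linarith
    linarith
  have h := (hasSubgaussianMGF_of_mem_Icc (μ := ν) hg.aemeasurable
    (Filter.Eventually.of_forall hIcc)).mgf_le l
  simp only [mgf, mul_sub, Real.exp_sub, integral_div] at h
  rw [div_le_iff₀ (Real.exp_pos _), ← Real.exp_add] at h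
  refine h.trans (le_of_eq ?_)
  congr 1
  simp
  ring

lemma integrable_of_bounded {Ω : Type*} [MeasurableSpace Ω] {μ : Measure Ω} [IsFiniteMeasure μ]
    {f : Ω → ℝ} (hf : Measurable f) {C : ℝ} (hC : ∀ z, |f z| ≤ C) : Integrable f μ :=
  Integrable.of_bound hf.aestronglyMeasurable C (Filter.Eventually.of_forall hC)

lemma abs_exp_mul_le {x C : ℝ} (l : ℝ) (h : |x| ≤ C) : |Real.exp (l * x)| ≤ Real.exp (|l| * C) := by
  rw [abs_of_pos (Real.exp_pos _)]
  refine Real.exp_le_exp.mpr ((le_abs_self _).trans ?_)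
  rw [abs_mul]
  exact mul_le_mul_of_nonneg_left h (abs_nonneg l)

/-- The exponential moment bound behind McDiarmid's inequality. -/
theorem integral_exp_mul_le_of_bounded_differences {n : ℕ} (ν : Fin n → Measure Z)
    [∀ i, IsProbabilityMeasure (ν i)] {F : (Fin n → Z) → ℝ} (hF : Measurable F) {C : ℝ}
    (hC : ∀ z, |F z| ≤ C) (hdiff : ∀ z i a, |F z - F (Function.update z i a)| ≤ 1) (l : ℝ) :
    ∫ z, Real.exp (l * F z) ∂Measure.pi ν ≤
      Real.exp (l * ∫ z, F z ∂Measure.pi ν + n * l ^ 2 / 8) := by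
  induction n with
  | zero =>
    have h : ∀ z : Fin 0 → Z, F z = F default := fun z => by rw [Subsingleton.elim z default]
    simp [h]
  | succ n ih =>
    set π := Measure.pi fun j : Fin n => ν j.succ with hπ
    have hcons := (measurePreserving_cons ν).measurable
    have hFc : Measurable fun p : Z × (Fin n → Z) => F (Fin.cons p.1 p.2) := hF.comp hcons
    have hFa : ∀ a, Measurable fun w : Fin n → Z => F (Fin.cons a w) := fun a =>
      hFc.comp measurable_prodMk_left
    have hFi : ∀ a, Integrable (fun w : Fin n → Z => F (Fin.cons a w)) π := fun a =>
      integrable_of_bounded (hFa a) fun w => hC _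
    have hgm : Measurable fun a => ∫ w, F (Fin.cons a w) ∂π :=
      (hFc.stronglyMeasurable.integral_prod_right (ν := π)).measurable
    have hgC : ∀ a, |∫ w, F (Fin.cons a w) ∂π| ≤ C := fun a => by
      simpa using norm_integral_le_of_norm_le_const (μ := π) (f := fun w => F (Fin.cons a w))
        (Filter.Eventually.of_forall fun w => hC (Fin.cons a w))
    -- Averaging over the remaining coordinates preserves the unit oscillation in the first one, so
    -- Hoeffding's lemma applies to the conditional mean.
    have hosc : ∀ a b, |(∫ w, F (Fin.cons a w) ∂π) - ∫ w, F (Fin.cons b w) ∂π| ≤ 1 := by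
      intro a b
      rw [← integral_sub (hFi a) (hFi b)]
      simpa using norm_integral_le_of_norm_le_const (μ := π) (C := 1)
        (f := fun w => F (Fin.cons a w) - F (Fin.cons b w))
        (Filter.Eventually.of_forall fun w => by
          simpa [Fin.update_cons_zero] using hdiff (Fin.cons a w) 0 b)
    have hstep : ∀ a, ∫ w, Real.exp (l * F (Fin.cons a w)) ∂π ≤
        Real.exp (l * (∫ w, F (Fin.cons a w) ∂π) + n * l ^ 2 / 8) := fun a =>
      ih (fun j => ν j.succ) (hFa a) (fun w => hC _) fun w i b => by
        simpa [Fin.cons_update] using hdiff (Fin.cons a w) i.succ b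
    have hexp : Integrable (fun p : Z × (Fin n → Z) => Real.exp (l * F (Fin.cons p.1 p.2)))
        ((ν 0).prod π) :=
      integrable_of_bounded (hFc.const_mul l).exp fun p => abs_exp_mul_le l (hC _)
    have hFp : Integrable (fun p : Z × (Fin n → Z) => F (Fin.cons p.1 p.2)) ((ν 0).prod π) :=
      integrable_of_bounded hFc fun p => hC _
    rw [integral_pi_cons ν (hF.const_mul l).exp.aestronglyMeasurable,
      integral_pi_cons ν hF.aestronglyMeasurable, integral_prod _ hexp, integral_prod _ hFp]
    calc ∫ a, ∫ w, Real.exp (l * F (Fin.cons a w)) ∂π ∂ν 0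
        ≤ ∫ a, Real.exp (n * l ^ 2 / 8) * Real.exp (l * (∫ w, F (Fin.cons a w) ∂π)) ∂ν 0 := by
          refine integral_mono hexp.integral_prod_left
            ((integrable_of_bounded (hgm.const_mul l).exp fun a =>
              abs_exp_mul_le l (hgC a)).const_mul _) fun a => ?_
          simpa [← Real.exp_add, add_comm] using hstep a
      _ ≤ Real.exp (n * l ^ 2 / 8) *
          Real.exp (l * (∫ a, ∫ w, F (Fin.cons a w) ∂π ∂ν 0) + l ^ 2 / 8) := by
          rw [integral_const_mul]
          exact mul_le_mul_of_nonneg_left (integral_exp_mul_le_of_abs_sub_le_one (ν 0) hgm hosc l)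
            (Real.exp_pos _).le
      _ = _ := by
          rw [← Real.exp_add]
          congr 1
          push_cast
          ring

/-- **McDiarmid's inequality**, for unit differences. -/
theorem measure_ge_le_of_bounded_differences {n : ℕ} (hn : 0 < n) (ν : Fin n → Measure Z)
    [∀ i, IsProbabilityMeasure (ν i)] {F : (Fin n → Z) → ℝ} (hF : Measurable F) {C : ℝ}
    (hC : ∀ z, |F z| ≤ C) (hdiff : ∀ z i a, |F z - F (Function.update z i a)| ≤ 1)
    {s : ℝ} (hs : 0 ≤ s) :
    (Measure.pi ν).real {z | (∫ z, F z ∂Measure.pi ν) + s ≤ F z} ≤ Real.exp (-2 * s ^ 2 / n) := by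
  have hn' : (0 : ℝ) < n := by exact_mod_cast hn
  -- The minimiser of −ls + nl²/8.
  set l : ℝ := 4 * s / n with hl
  have h := measure_ge_le_exp_mul_mgf (μ := Measure.pi ν) (X := F) (t := l)
    ((∫ z, F z ∂Measure.pi ν) + s) (by positivity)
    (integrable_of_bounded (hF.const_mul l).exp fun z => abs_exp_mul_le l (hC z))
  refine h.trans ((mul_le_mul_of_nonneg_left
    (integral_exp_mul_le_of_bounded_differences ν hF hC hdiff l) (Real.exp_pos _).le).trans ?_)
  rw [← Real.exp_add]
  refine Real.exp_le_exp.mpr (le_of_eq ?_)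
  rw [hl]
  field_simp
  ring

end BoundedDifferences

/-! ### Symmetrisation and contraction over finite index sets -/

section Contraction

variable {T : Type*} [Finite T]

lemma le_ciSup_of_finite (f : T → ℝ) (t : T) : f t ≤ ⨆ t, f t :=
  le_ciSup (Set.finite_range f).bddAbove t

variable [Nonempty T]

lemma abs_ciSup_le {f : T → ℝ} {C : ℝ} (h : ∀ t, |f t| ≤ C) : |⨆ t, f t| ≤ C := by
  obtain ⟨t, ht⟩ := exists_eq_ciSup_of_finite (f := f)
  rw [← ht]
  exact h t

lemma abs_ciSup_sub_ciSup_le {f g : T → ℝ} {C : ℝ} (h : ∀ t, |f t - g t| ≤ C) :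
    |(⨆ t, f t) - ⨆ t, g t| ≤ C := by
  have h1 : (⨆ t, f t) ≤ (⨆ t, g t) + C := ciSup_le fun t => by
    have := (abs_le.mp (h t)).2
    have := le_ciSup_of_finite g t
    linarith
  have h2 : (⨆ t, g t) ≤ (⨆ t, f t) + C := ciSup_le fun t => by
    have := (abs_le.mp (h t)).1
    have := le_ciSup_of_finite f t
    linarith
  rw [abs_le]
  constructor <;> linarith

lemma integrable_ciSup {Ω : Type*} [MeasurableSpace Ω] {μ : Measure Ω} {f : T → Ω → ℝ}
    (hm : ∀ t, Measurable (f t)) (hf : ∀ t, Integrable (f t) μ) :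
    Integrable (fun z => ⨆ t, f t z) μ := by
  have := Fintype.ofFinite T
  refine (integrable_finsetSum Finset.univ fun t _ => (hf t).abs).mono'
    (Measurable.iSup hm).aestronglyMeasurable (Filter.Eventually.of_forall fun z => ?_)
  exact abs_ciSup_le fun t =>
    Finset.single_le_sum (f := fun t => |f t z|) (fun _ _ => abs_nonneg _) (Finset.mem_univ t)

variable {H : Type*} [NormedAddCommGroup H] [InnerProductSpace ℝ H]

/-- The contraction principle for one random sign. -/
lemma ciSup_add_ciSup_le_of_contraction (G a b : T → ℝ) (h : ∀ s t, |a s - a t| ≤ |b s - b t|) :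
    (⨆ t, (G t + a t)) + (⨆ t, (G t - a t)) ≤ (⨆ t, (G t + b t)) + ⨆ t, (G t - b t) := by
  obtain ⟨s, hs⟩ := exists_eq_ciSup_of_finite (f := fun t => G t + a t)
  obtain ⟨t, ht⟩ := exists_eq_ciSup_of_finite (f := fun t => G t - a t)
  rw [← hs, ← ht]
  have h1 := le_ciSup_of_finite (fun t => G t + b t) s
  have h2 := le_ciSup_of_finite (fun t => G t - b t) t
  have h3 := le_ciSup_of_finite (fun t => G t + b t) t
  have h4 := le_ciSup_of_finite (fun t => G t - b t) s
  -- The gain a s − a t is at most |b s − b t|; the sign of b s − b t decides which of the two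
  -- maximisers is inserted in which supremum on the right.
  have h5 := (le_abs_self _).trans (h s t)
  rcases abs_cases (b s - b t) with h6 | h6 <;> linarith

variable [MeasurableSpace H] [BorelSpace H] [SecondCountableTopology H]

/-- Symmetrisation and contraction in one coordinate. -/
lemma integral_ciSup_add_sub_le (ν : Measure H) [IsProbabilityMeasure ν] (G : T → ℝ)
    {ψ : T → H → ℝ} (hψ : ∀ t, Measurable (ψ t)) (hψ1 : ∀ t z, |ψ t z| ≤ 1) {u : T → H}
    (hlip : ∀ s t z, 2 * |ψ s z - ψ t z| ≤ |inner ℝ (u s) z - inner ℝ (u t) z|)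
    (hν : Integrable (fun z => z) ν) :
    ∫ z, ⨆ t, (G t + (ψ t z - ∫ z, ψ t z ∂ν)) ∂ν ≤
      ∫ z, ((⨆ t, (G t + inner ℝ (u t) z)) + ⨆ t, (G t - inner ℝ (u t) z)) / 2 ∂ν := by
  have hψi : ∀ t, Integrable (ψ t) ν := fun t => integrable_of_bounded (hψ t) (hψ1 t)
  have hui : ∀ t, Integrable (fun z => inner ℝ (u t) z) ν := fun t => hν.const_inner (u t)
  have hum : ∀ t, Measurable fun z : H => inner ℝ (u t) z := fun t => by fun_prop
  have i1 : Integrable (fun z => ⨆ t, (G t + 2 * ψ t z)) ν :=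
    integrable_ciSup (fun t => ((hψ t).const_mul 2).const_add _)
      fun t => (integrable_const _).add ((hψi t).const_mul 2)
  have i2 : Integrable (fun z => ⨆ t, (G t - 2 * ψ t z)) ν :=
    integrable_ciSup (fun t => ((hψ t).const_mul 2).const_sub _)
      fun t => (integrable_const _).sub ((hψi t).const_mul 2)
  have i3 : Integrable (fun z => ⨆ t, (G t + inner ℝ (u t) z)) ν :=
    integrable_ciSup (fun t => (hum t).const_add _) fun t => (integrable_const _).add (hui t)
  have i4 : Integrable (fun z => ⨆ t, (G t - inner ℝ (u t) z)) ν :=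
    integrable_ciSup (fun t => (hum t).const_sub _) fun t => (integrable_const _).sub (hui t)
  have i0 : Integrable (fun z => ⨆ t, (G t + (ψ t z - ∫ z, ψ t z ∂ν))) ν :=
    integrable_ciSup (fun t => ((hψ t).sub_const _).const_add _)
      fun t => (integrable_const _).add ((hψi t).sub (integrable_const _))
  have hmean : (⨆ t, (G t - 2 * ∫ z, ψ t z ∂ν)) ≤ ∫ z, ⨆ t, (G t - 2 * ψ t z) ∂ν := by
    refine ciSup_le fun t => ?_
    have : G t - 2 * ∫ z, ψ t z ∂ν = ∫ z, (G t - 2 * ψ t z) ∂ν := by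
      rw [integral_sub (integrable_const _) ((hψi t).const_mul 2), integral_const_mul]
      simp
    rw [this]
    exact integral_mono ((integrable_const _).sub ((hψi t).const_mul 2)) i2
      fun z => le_ciSup_of_finite (fun t => G t - 2 * ψ t z) t
  -- Pointwise, G + ψ − ∫ψ is the midpoint of G + 2ψ and G − 2∫ψ, and `hmean` (Jensen) moves the
  -- second supremum inside the integral. By linearity both suprema are then integrated over the
  -- same z, so neither an independent copy nor random signs are needed.
  calc ∫ z, ⨆ t, (G t + (ψ t z - ∫ z, ψ t z ∂ν)) ∂ν
      ≤ ∫ z, ((⨆ t, (G t + 2 * ψ t z)) + ∫ z, ⨆ t, (G t - 2 * ψ t z) ∂ν) / 2 ∂ν := by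
        refine integral_mono i0 ((i1.add (integrable_const _)).div_const 2) fun z => ?_
        refine ciSup_le fun t => ?_
        have h1 := le_ciSup_of_finite (fun t => G t + 2 * ψ t z) t
        have h2 := (le_ciSup_of_finite (fun t => G t - 2 * ∫ z, ψ t z ∂ν) t).trans hmean
        simp only at h1 h2 ⊢
        linarith
    _ = ∫ z, ((⨆ t, (G t + 2 * ψ t z)) + ⨆ t, (G t - 2 * ψ t z)) / 2 ∂ν := by
        rw [integral_div, integral_div, integral_add i1 (integrable_const _), integral_add i1 i2]
        simp
    _ ≤ _ := by
        refine integral_mono ((i1.add i2).div_const 2) ((i3.add i4).div_const 2) fun z => ?_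
        refine div_le_div_of_nonneg_right ?_ zero_le_two
        refine ciSup_add_ciSup_le_of_contraction G _ _ fun s t => ?_
        rw [← mul_sub, abs_mul, abs_two]
        exact hlip s t z

lemma integral_sqrt_le_sqrt_integral {Ω : Type*} [MeasurableSpace Ω] {μ : Measure Ω}
    [IsProbabilityMeasure μ] {f : Ω → ℝ} (hf : Integrable f μ) (h0 : ∀ z, 0 ≤ f z) :
    Integrable (fun z => √(f z)) μ ∧ ∫ z, √(f z) ∂μ ≤ √(∫ z, f z ∂μ) := by
  have hi : Integrable (fun z => √(f z)) μ := by
    refine (hf.add (integrable_const 1)).mono'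
      (Real.continuous_sqrt.comp_aestronglyMeasurable hf.aestronglyMeasurable)
      (Filter.Eventually.of_forall fun z => ?_)
    rw [Real.norm_of_nonneg (Real.sqrt_nonneg _)]
    simp only [Pi.add_apply]
    nlinarith [Real.sq_sqrt (h0 z), sq_nonneg (√(f z) - 1), Real.sqrt_nonneg (f z)]
  exact ⟨hi, Real.strictConcaveOn_sqrt.concaveOn.le_map_integral Real.continuous_sqrt.continuousOn
    isClosed_Ici (Filter.Eventually.of_forall h0) hf hi⟩

/-- The expected supremum of a centred process indexed by a finite family of contractions of
linear functionals, for independent square-integrable vectors. -/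
theorem integral_ciSup_sum_le {n : ℕ} (ν : Fin n → Measure H) [∀ i, IsProbabilityMeasure (ν i)]
    {ψ : T → H → ℝ} (hψ : ∀ t, Measurable (ψ t)) (hψ1 : ∀ t z, |ψ t z| ≤ 1) {u : T → H}
    (hlip : ∀ s t z, 2 * |ψ s z - ψ t z| ≤ |inner ℝ (u s) z - inner ℝ (u t) z|)
    (hν : ∀ i, MemLp (fun z => z) 2 (ν i)) {M : ℝ} (hM : ∀ t, ‖u t‖ ≤ M) (w : H) :
    ∫ z, ⨆ t, (inner ℝ (u t) w + ∑ q, (ψ t (z q) - ∫ x, ψ t x ∂ν q)) ∂Measure.pi ν ≤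
      M * √(‖w‖ ^ 2 + ∑ q, ∫ x, ‖x‖ ^ 2 ∂ν q) := by
  have hM0 : 0 ≤ M := (norm_nonneg _).trans (hM (Classical.arbitrary T))
  induction n generalizing w with
  | zero =>
    simp only [Finset.univ_eq_empty, Finset.sum_empty, add_zero, integral_const, probReal_univ,
      smul_eq_mul, one_mul, Real.sqrt_sq (norm_nonneg w)]
    exact ciSup_le fun t => (real_inner_le_norm _ _).trans
      (mul_le_mul_of_nonneg_right (hM t) (norm_nonneg w))
  | succ n ih =>
    set π := Measure.pi fun j : Fin n => ν j.succ with hπ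
    set V := ∑ q : Fin n, ∫ x, ‖x‖ ^ 2 ∂ν q.succ with hV
    have hV0 : 0 ≤ V := Finset.sum_nonneg fun q _ => integral_nonneg fun x => sq_nonneg _
    set R : T → (Fin n → H) → ℝ := fun t z => ∑ q, (ψ t (z q) - ∫ x, ψ t x ∂ν q.succ) with hR
    have hRm : ∀ t, Measurable (R t) := fun t => Finset.measurable_sum _ fun q _ =>
      ((hψ t).comp (measurable_pi_apply q)).sub_const _
    have hint : ∀ (t : T) (i : Fin (n + 1)), Integrable (ψ t) (ν i) := fun t i =>
      integrable_of_bounded (hψ t) (hψ1 t)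
    have hRi : ∀ t, Integrable (R t) π := fun t => integrable_finsetSum _ fun q _ =>
      (integrable_of_bounded ((hψ t).comp (measurable_pi_apply q)) fun z => hψ1 t _).sub
        (integrable_const _)
    have hν1 : Integrable (fun z : H => z) (ν 0) := (hν 0).integrable one_le_two
    have hν2 : Integrable (fun z : H => ‖z‖ ^ 2) (ν 0) := (hν 0).integrable_norm_pow two_ne_zero
    have hum : ∀ t, Measurable fun z : H => inner ℝ (u t) z := fun t => by fun_prop
    have hui : ∀ t, Integrable (fun z => inner ℝ (u t) z) (ν 0) := fun t => hν1.const_inner (u t)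
    have j0 : Integrable (fun p : H × (Fin n → H) => ⨆ t, ((inner ℝ (u t) w + R t p.2) +
        (ψ t p.1 - ∫ x, ψ t x ∂ν 0))) ((ν 0).prod π) :=
      integrable_ciSup (fun t => (((hRm t).comp measurable_snd).const_add _).add
        (((hψ t).comp measurable_fst).sub_const _)) fun t =>
        ((integrable_const _).add ((hRi t).comp_snd _)).add
          (((hint t 0).comp_fst _).sub (integrable_const _))
    have j1 : Integrable (fun p : H × (Fin n → H) => ⨆ t, ((inner ℝ (u t) w + R t p.2) +
        inner ℝ (u t) p.1)) ((ν 0).prod π) :=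
      integrable_ciSup (fun t => (((hRm t).comp measurable_snd).const_add _).add
        ((hum t).comp measurable_fst)) fun t =>
        ((integrable_const _).add ((hRi t).comp_snd _)).add ((hui t).comp_fst _)
    have j2 : Integrable (fun p : H × (Fin n → H) => ⨆ t, ((inner ℝ (u t) w + R t p.2) -
        inner ℝ (u t) p.1)) ((ν 0).prod π) :=
      integrable_ciSup (fun t => (((hRm t).comp measurable_snd).const_add _).sub
        ((hum t).comp measurable_fst)) fun t =>
        ((integrable_const _).add ((hRi t).comp_snd _)).sub ((hui t).comp_fst _)
    have j3 := (j1.add j2).div_const 2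
    have hIH : ∀ v, ∫ z, ⨆ t, (inner ℝ (u t) v + R t z) ∂π ≤ M * √(‖v‖ ^ 2 + V) := fun v =>
      ih (fun j => ν j.succ) (fun j => hν j.succ) v
    -- The parallelogram law averages ‖w ± x‖² to ‖w‖² + ‖x‖². The vector w thus plays the role of
    -- the signed sum of the coordinates already treated.
    have hsum : ∀ x : H, √(‖w + x‖ ^ 2 + V) + √(‖w - x‖ ^ 2 + V) ≤
        2 * √(‖x‖ ^ 2 + (‖w‖ ^ 2 + V)) := by
      intro x
      have hp := parallelogram_law_with_norm ℝ w x
      have h1 := Real.sq_sqrt (show 0 ≤ ‖w + x‖ ^ 2 + V by positivity)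
      have h2 := Real.sq_sqrt (show 0 ≤ ‖w - x‖ ^ 2 + V by positivity)
      have h3 := Real.sq_sqrt (show 0 ≤ ‖x‖ ^ 2 + (‖w‖ ^ 2 + V) by positivity)
      refine abs_le_of_sq_le_sq' ?_ (by positivity) |>.2
      nlinarith [sq_nonneg (√(‖w + x‖ ^ 2 + V) - √(‖w - x‖ ^ 2 + V))]
    have hsq := integral_sqrt_le_sqrt_integral (μ := ν 0)
      (f := fun x : H => ‖x‖ ^ 2 + (‖w‖ ^ 2 + V)) (hν2.add (integrable_const _))
      fun x => by positivity
    have hmeas : Measurable fun z : Fin (n + 1) → H =>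
        ⨆ t, (inner ℝ (u t) w + ∑ q, (ψ t (z q) - ∫ x, ψ t x ∂ν q)) :=
      Measurable.iSup fun t => (Finset.measurable_sum _ fun q _ =>
        ((hψ t).comp (measurable_pi_apply q)).sub_const _).const_add _
    rw [integral_pi_cons ν hmeas.aestronglyMeasurable]
    calc _ = ∫ p : H × (Fin n → H), ⨆ t, ((inner ℝ (u t) w + R t p.2) +
        (ψ t p.1 - ∫ x, ψ t x ∂ν 0)) ∂(ν 0).prod π := by
          refine integral_congr_ae (Filter.Eventually.of_forall fun p => ?_)
          simp only [Fin.sum_univ_succ, Fin.cons_zero, Fin.cons_succ, hR]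
          congr 1
          ext t
          ring
      _ = ∫ z, ∫ x, ⨆ t, ((inner ℝ (u t) w + R t z) + (ψ t x - ∫ x, ψ t x ∂ν 0)) ∂ν 0 ∂π :=
          integral_prod_symm _ j0
      _ ≤ ∫ z, ∫ x, ((⨆ t, ((inner ℝ (u t) w + R t z) + inner ℝ (u t) x)) +
            ⨆ t, ((inner ℝ (u t) w + R t z) - inner ℝ (u t) x)) / 2 ∂ν 0 ∂π :=
          integral_mono j0.integral_prod_right j3.integral_prod_right fun z =>
            integral_ciSup_add_sub_le (ν 0) _ hψ hψ1 hlip hν1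
      -- The contraction was applied with the tail z frozen; the induction hypothesis is applied
      -- with the head x frozen, at the vectors w ± x.
      _ = ∫ x, ∫ z, ((⨆ t, ((inner ℝ (u t) w + R t z) + inner ℝ (u t) x)) +
            ⨆ t, ((inner ℝ (u t) w + R t z) - inner ℝ (u t) x)) / 2 ∂π ∂ν 0 := by
          rw [integral_integral_swap]
          exact j3.swap
      _ ≤ ∫ x, M * √(‖x‖ ^ 2 + (‖w‖ ^ 2 + V)) ∂ν 0 := by
          refine integral_mono j3.integral_prod_left (hsq.1.const_mul M) fun x => ?_
          have e1 : ∀ t z, inner ℝ (u t) w + R t z + inner ℝ (u t) x =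
              inner ℝ (u t) (w + x) + R t z := fun t z => by rw [inner_add_right]; ring
          have e2 : ∀ t z, inner ℝ (u t) w + R t z - inner ℝ (u t) x =
              inner ℝ (u t) (w - x) + R t z := fun t z => by rw [inner_sub_right]; ring
          simp only [e1, e2]
          have k : ∀ v, Integrable (fun z => ⨆ t, (inner ℝ (u t) v + R t z)) π := fun v =>
            integrable_ciSup (fun t => (hRm t).const_add _)
              fun t => (integrable_const _).add (hRi t)
          rw [integral_div, integral_add (k _) (k _)]
          have h1 := hIH (w + x)
          have h2 := hIH (w - x)
          have h3 := mul_le_mul_of_nonneg_left (hsum x) hM0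
          linarith
      _ ≤ M * √(‖w‖ ^ 2 + ∑ q, ∫ x, ‖x‖ ^ 2 ∂ν q) := by
          rw [integral_const_mul]
          refine mul_le_mul_of_nonneg_left (hsq.2.trans (le_of_eq ?_)) hM0
          rw [integral_add hν2 (integrable_const _), Fin.sum_univ_succ]
          simp only [integral_const, probReal_univ, one_smul]
          congr 1
          ring

end Contraction


/-! ### Uniform count of the large block averages -/

noncomputable section

/-- A Lipschitz function of `|x|` equal to `0` below `r / 2` and to `1` above `r`. -/
def bump (r x : ℝ) : ℝ := max 0 (min 1 (2 * |x| / r - 1))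

lemma bump_nonneg (r x : ℝ) : 0 ≤ bump r x := le_max_left _ _

lemma bump_le_one (r x : ℝ) : bump r x ≤ 1 := max_le zero_le_one (min_le_left _ _)

@[fun_prop]
lemma continuous_bump (r : ℝ) : Continuous (bump r) := by
  unfold bump
  fun_prop

lemma bump_eq_one {r x : ℝ} (hr : 0 < r) (hx : r ≤ |x|) : bump r x = 1 := by
  have : 1 ≤ 2 * |x| / r - 1 := by
    rw [le_sub_iff_add_le, le_div_iff₀ hr]
    linarith
  simp [bump, min_eq_left this]

/-- With a = 2|x|/r, the bump is at most max(0, a − 1), hence at most a². This is the majorant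
behind the Chebyshev bound. -/
lemma bump_le_sq {r : ℝ} (x : ℝ) : bump r x ≤ 4 / r ^ 2 * x ^ 2 := by
  have h : (2 * |x| / r) ^ 2 = 4 / r ^ 2 * x ^ 2 := by
    rw [div_pow, mul_pow, sq_abs]
    ring
  rw [← h]
  refine max_le (sq_nonneg _) ((min_le_right _ _).trans ?_)
  nlinarith [sq_nonneg (2 * |x| / r - 1)]

lemma abs_bump_sub_le {r : ℝ} (hr : 0 < r) (x y : ℝ) :
    |bump r x - bump r y| ≤ 2 / r * |x - y| := by
  have h1 : |bump r x - bump r y| ≤ |(2 * |x| / r - 1) - (2 * |y| / r - 1)| := by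
    unfold bump
    refine (abs_max_sub_max_le_max _ _ _ _).trans ?_
    rw [sub_self, abs_zero, max_eq_right (abs_nonneg _)]
    refine (abs_min_sub_min_le_max _ _ _ _).trans ?_
    rw [sub_self, abs_zero, max_eq_right (abs_nonneg _)]
  refine h1.trans ?_
  have h2 : (2 * |x| / r - 1) - (2 * |y| / r - 1) = 2 / r * (|x| - |y|) := by ring
  rw [h2, abs_mul, abs_of_pos (by positivity : 0 < 2 / r)]
  exact mul_le_mul_of_nonneg_left (abs_abs_sub_abs_le_abs_sub x y) (by positivity)

variable {H : Type*} [NormedAddCommGroup H] [InnerProductSpace ℝ H]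
  [MeasurableSpace H] [BorelSpace H] [SecondCountableTopology H]

lemma integral_bump_le {ν : Measure H} [IsProbabilityMeasure ν]
    (hν : MemLp (fun z => z) 2 ν) {r δ s : ℝ} (hr : 0 < r) (hs : 12 * s ≤ δ * r ^ 2) (h : H)
    (hvar : ∫ x, inner ℝ h x ^ 2 ∂ν ≤ s) : ∫ x, bump r (inner ℝ h x) ∂ν ≤ δ / 3 := by
  have hsq : Integrable (fun x => inner ℝ h x ^ 2) ν := (hν.const_inner h).integrable_sq
  calc ∫ x, bump r (inner ℝ h x) ∂ν ≤ ∫ x, 4 / r ^ 2 * inner ℝ h x ^ 2 ∂ν :=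
        integral_mono (integrable_of_bounded (by fun_prop) fun z =>
          (abs_of_nonneg (bump_nonneg _ _)).trans_le (bump_le_one _ _)) (hsq.const_mul _)
          fun x => bump_le_sq _
    _ ≤ 4 / r ^ 2 * s := by
        rw [integral_const_mul]
        exact mul_le_mul_of_nonneg_left hvar (by positivity)
    _ ≤ δ / 3 := by
        rw [div_mul_eq_mul_div, div_le_div_iff₀ (by positivity) (by norm_num)]
        linarith

/-- With high probability, along each direction of a finite family only a small proportion of
independent vectors has a large component. -/
theorem measure_exists_sum_bump_ge_le {T : Type*} [Finite T] [Nonempty T] {Q : ℕ} (hQ : 0 < Q)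
    (ν : Fin Q → Measure H) [∀ q, IsProbabilityMeasure (ν q)]
    (hν : ∀ q, MemLp (fun z => z) 2 (ν q)) {r δ s V : ℝ} (hr : 0 < r) (hδ : 0 < δ)
    (hs : 12 * s ≤ δ * r ^ 2) (hV : 576 * V ≤ δ ^ 2 * r ^ 2 * Q)
    (hvar : ∀ q (h : H), ‖h‖ ≤ 1 → ∫ x, inner ℝ h x ^ 2 ∂ν q ≤ s)
    (hnorm : ∀ q, ∫ x, ‖x‖ ^ 2 ∂ν q ≤ V) (h : T → H) (hh : ∀ t, ‖h t‖ ≤ 1) :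
    (Measure.pi ν).real {z | ∃ t, 7 / 12 * δ * Q ≤ ∑ q, bump r (inner ℝ (h t) (z q))} ≤
      Real.exp (-(Q * δ ^ 2 / 72)) := by
  have hQ' : (0 : ℝ) < Q := by exact_mod_cast hQ
  set ψ : T → H → ℝ := fun t x => bump r (inner ℝ (h t) x) with hψdef
  have hψ : ∀ t, Measurable (ψ t) := fun t => by fun_prop
  have hψ0 : ∀ t x, 0 ≤ ψ t x := fun t x => bump_nonneg _ _
  have hψ1 : ∀ t x, ψ t x ≤ 1 := fun t x => bump_le_one _ _
  have hψa : ∀ t x, |ψ t x| ≤ 1 := fun t x => (abs_of_nonneg (hψ0 t x)).trans_le (hψ1 t x)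
  have hψi : ∀ t q, Integrable (ψ t) (ν q) := fun t q => integrable_of_bounded (hψ t) (hψa t)
  have hc0 : ∀ t q, 0 ≤ ∫ x, ψ t x ∂ν q := fun t q => integral_nonneg (hψ0 t)
  have hc1 : ∀ t q, ∫ x, ψ t x ∂ν q ≤ 1 := fun t q => by
    simpa using integral_mono (hψi t q) (integrable_const 1) (hψ1 t)
  have hc : ∀ t q, ∫ x, ψ t x ∂ν q ≤ δ / 3 := fun t q =>
    integral_bump_le (hν q) hr hs (h t) (hvar q _ (hh t))
  set F : (Fin Q → H) → ℝ := fun z => ⨆ t, ∑ q, (ψ t (z q) - ∫ x, ψ t x ∂ν q) with hF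
  have hFm : Measurable F := Measurable.iSup fun t => Finset.measurable_sum _ fun q _ =>
    ((hψ t).comp (measurable_pi_apply q)).sub_const _
  have hFC : ∀ z, |F z| ≤ Q := fun z => abs_ciSup_le fun t => by
    refine (Finset.abs_sum_le_sum_abs _ _).trans ?_
    refine (Finset.sum_le_sum (g := fun _ => (1 : ℝ)) fun q _ => ?_).trans (by simp)
    rw [abs_le]
    constructor <;> linarith [hψ0 t (z q), hψ1 t (z q), hc0 t q, hc1 t q]
  -- Changing one coordinate alters a single summand; its centring cancels and the bump takes values
  -- in [0, 1].
  have hdiff : ∀ z i a, |F z - F (Function.update z i a)| ≤ 1 := fun z i a =>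
    abs_ciSup_sub_ciSup_le fun t => by
      rw [← Finset.sum_sub_distrib, Finset.sum_eq_single i]
      · simp only [Function.update_self]
        rw [abs_le]
        constructor <;> linarith [hψ0 t (z i), hψ1 t (z i), hψ0 t a, hψ1 t a]
      · intro q _ hq
        simp [Function.update_of_ne hq]
      · simp
  have hmean : ∫ z, F z ∂Measure.pi ν ≤ δ * Q / 6 := by
    -- The bump is 2/r-Lipschitz and symmetrisation doubles it, hence the vectors (4/r) h t; the
    -- initial vector w is 0.
    have key := integral_ciSup_sum_le ν hψ hψa (u := fun t => (4 / r) • h t) (M := 4 / r)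
      (fun s t z => by
        have := abs_bump_sub_le hr (inner ℝ (h s) z) (inner ℝ (h t) z)
        rw [real_inner_smul_left, real_inner_smul_left, ← mul_sub, abs_mul,
          abs_of_pos (by positivity : 0 < 4 / r)]
        calc 2 * |ψ s z - ψ t z| ≤ 2 * (2 / r * |inner ℝ (h s) z - inner ℝ (h t) z|) := by gcongr
          _ = _ := by ring) hν
      (fun t => by
        rw [norm_smul, Real.norm_of_nonneg (by positivity)]
        exact mul_le_of_le_one_right (by positivity) (hh t)) 0
    simp only [inner_zero_right, zero_add, norm_zero, ne_eq, OfNat.ofNat_ne_zero,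
      not_false_eq_true, zero_pow] at key
    refine key.trans ?_
    have hsum : ∑ q, ∫ x, ‖x‖ ^ 2 ∂ν q ≤ (δ * r * Q / 24) ^ 2 := by
      calc ∑ q, ∫ x, ‖x‖ ^ 2 ∂ν q ≤ ∑ _q : Fin Q, V := Finset.sum_le_sum fun q _ => hnorm q
        _ = Q * V := by simp
        _ ≤ (δ * r * Q / 24) ^ 2 := by nlinarith
    calc 4 / r * √(∑ q, ∫ x, ‖x‖ ^ 2 ∂ν q) ≤ 4 / r * (δ * r * Q / 24) :=
          mul_le_mul_of_nonneg_left (Real.sqrt_le_iff.mpr ⟨by positivity, hsum⟩) (by positivity)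
      _ = δ * Q / 6 := by field_simp; norm_num
  -- The exponent is 2(δQ/12)²/Q = Qδ²/72, and the budget is 1/3 + 1/6 + 1/12 = 7/12.
  have hMc := measure_ge_le_of_bounded_differences hQ ν hFm hFC hdiff
    (s := δ * Q / 12) (by positivity)
  calc _ ≤ (Measure.pi ν).real {z | (∫ z, F z ∂Measure.pi ν) + δ * Q / 12 ≤ F z} := by
        refine measureReal_mono ?_
        rintro z ⟨t, ht⟩
        have h1 : ∑ q, ∫ x, ψ t x ∂ν q ≤ δ * Q / 3 :=
          (Finset.sum_le_sum fun q _ => hc t q).trans (by simp; linarith)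
        have h2 := le_ciSup_of_finite (fun t => ∑ q, (ψ t (z q) - ∫ x, ψ t x ∂ν q)) t
        simp only [Finset.sum_sub_distrib] at h2
        simp only [Set.mem_ofPred_eq, hF, Finset.sum_sub_distrib] at hmean ⊢
        linarith
    _ ≤ _ := hMc
    _ = _ := by
        congr 1
        field_simp
        norm_num

/-- The finite families are replaced by the whole unit ball. -/
theorem exists_measurableSet_forall_sum_bump_le {Q : ℕ} (hQ : 0 < Q)
    (ν : Fin Q → Measure H) [∀ q, IsProbabilityMeasure (ν q)]
    (hν : ∀ q, MemLp (fun z => z) 2 (ν q)) {r δ s V : ℝ} (hr : 0 < r) (hδ : 0 < δ)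
    (hs : 12 * s ≤ δ * r ^ 2) (hV : 576 * V ≤ δ ^ 2 * r ^ 2 * Q)
    (hvar : ∀ q (h : H), ‖h‖ ≤ 1 → ∫ x, inner ℝ h x ^ 2 ∂ν q ≤ s)
    (hnorm : ∀ q, ∫ x, ‖x‖ ^ 2 ∂ν q ≤ V) :
    ∃ A : Set (Fin Q → H), MeasurableSet A ∧
      ENNReal.ofReal (1 - Real.exp (-(Q * δ ^ 2 / 72))) ≤ Measure.pi ν A ∧
      ∀ z ∈ A, ∀ h : H, ‖h‖ ≤ 1 → ∑ q, bump r (inner ℝ h (z q)) ≤ 7 / 12 * δ * Q := by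
  have : Nonempty (Metric.closedBall (0 : H) 1) := ⟨⟨0, by simp⟩⟩
  set d := TopologicalSpace.denseSeq (Metric.closedBall (0 : H) 1) with hd
  have hd1 : ∀ k, ‖(d k : H)‖ ≤ 1 := fun k => mem_closedBall_zero_iff.mp (d k).2
  -- The bad events of growing initial segments of a dense sequence increase, and their bound does
  -- not depend on the segment, so it passes to the union.
  set B : ℕ → Set (Fin Q → H) := fun k =>
    {z | ∃ t : Fin (k + 1), 7 / 12 * δ * Q ≤ ∑ q, bump r (inner ℝ (d t : H) (z q))} with hB
  have hBk : ∀ k, Measure.pi ν (B k) ≤ ENNReal.ofReal (Real.exp (-(Q * δ ^ 2 / 72))) := fun k => by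
    rw [← ofReal_measureReal]
    exact ENNReal.ofReal_le_ofReal (measure_exists_sum_bump_ge_le hQ ν hν hr hδ hs hV hvar hnorm
      (fun t : Fin (k + 1) => (d t : H)) fun t => hd1 t)
  have hmono : Monotone B := by
    rintro k l hkl z ⟨t, ht⟩
    exact ⟨⟨t, by omega⟩, ht⟩
  have hBm : ∀ k, MeasurableSet (B k) := fun k => by
    simp only [hB, Set.ofPred_exists]
    exact MeasurableSet.iUnion fun t => measurableSet_le measurable_const (by fun_prop)
  refine ⟨(⋃ k, B k)ᶜ, (MeasurableSet.iUnion hBm).compl, ?_, ?_⟩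
  · rw [prob_compl_eq_one_sub (MeasurableSet.iUnion hBm), hmono.measure_iUnion,
      ENNReal.ofReal_sub _ (Real.exp_pos _).le, ENNReal.ofReal_one]
    exact tsub_le_tsub_left (iSup_le hBk) 1
  · intro z hz
    have hclosed : IsClosed {h : Metric.closedBall (0 : H) 1 |
        ∑ q, bump r (inner ℝ (h : H) (z q)) ≤ 7 / 12 * δ * Q} :=
      isClosed_le (by fun_prop) continuous_const
    have hall : ∀ h : Metric.closedBall (0 : H) 1,
        ∑ q, bump r (inner ℝ (h : H) (z q)) ≤ 7 / 12 * δ * Q := by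
      refine fun h => (TopologicalSpace.denseRange_denseSeq _).induction_on h hclosed fun k => ?_
      have : z ∉ B k := fun hk => hz (Set.mem_iUnion_of_mem k hk)
      simp only [hB, Set.mem_ofPred_eq, not_exists, not_le] at this
      exact (this (Fin.last k)).le
    exact fun h hh => hall ⟨h, by simpa using hh⟩

open Classical in
/-- Uniformly over all directions, few of the independent vectors have a large component. -/
theorem exists_measurableSet_forall_card_lt {Q : ℕ} (hQ : 0 < Q)
    (ν : Fin Q → Measure H) [∀ q, IsProbabilityMeasure (ν q)]
    (hν : ∀ q, MemLp (fun z => z) 2 (ν q)) {r δ s V : ℝ} (hr : 0 ≤ r) (hδ : 0 < δ)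
    (hs : 12 * s ≤ δ * r ^ 2) (hV : 576 * V ≤ δ ^ 2 * r ^ 2 * Q)
    (hvar : ∀ q (h : H), ‖h‖ ≤ 1 → ∫ x, inner ℝ h x ^ 2 ∂ν q ≤ s)
    (hnorm : ∀ q, ∫ x, ‖x‖ ^ 2 ∂ν q ≤ V) :
    ∃ A : Set (Fin Q → H), MeasurableSet A ∧
      ENNReal.ofReal (1 - Real.exp (-(Q * δ ^ 2 / 72))) ≤ Measure.pi ν A ∧
      ∀ z ∈ A, ∀ h : H,
        ((Finset.univ.filter fun q => r * ‖h‖ < |inner ℝ h (z q)|).card : ℝ) < δ * Q := by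
  have hQ' : (0 : ℝ) < Q := by exact_mod_cast hQ
  have hpos : 0 < δ * Q := by positivity
  -- For r = 0 the bump degenerates, but then V ≤ 0 and all the laws are Dirac masses at 0.
  rcases hr.eq_or_lt with rfl | hr
  · have hz : ∀ q, ν q {0} = 1 := fun q => by
      have hi : Integrable (fun x : H => ‖x‖ ^ 2) (ν q) := (hν q).integrable_norm_pow two_ne_zero
      have h0 : ∫ x, ‖x‖ ^ 2 ∂ν q = 0 :=
        le_antisymm ((hnorm q).trans (by norm_num at hV; linarith))
          (integral_nonneg fun x => sq_nonneg _)
      rw [integral_eq_zero_iff_of_nonneg (fun x => sq_nonneg _) hi] at h0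
      rw [← mem_ae_iff_prob_eq_one (measurableSet_singleton 0)]
      filter_upwards [h0] with x hx
      simpa using hx
    refine ⟨Set.univ.pi fun _ => {0}, MeasurableSet.univ_pi fun _ => measurableSet_singleton 0,
      ?_, fun z hz h => ?_⟩
    · rw [Measure.pi_pi]
      simp [hz, (Real.exp_pos _).le]
    · have : ∀ q, z q = 0 := fun q => by simpa using hz q
      simpa [this] using hpos
  · obtain ⟨A, hA, hAp, hAz⟩ := exists_measurableSet_forall_sum_bump_le hQ ν hν hr hδ hs hV hvar
      hnorm
    refine ⟨A, hA, hAp, fun z hz h => ?_⟩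
    rcases eq_or_ne h 0 with rfl | hne
    · simpa using hpos
    · have hn : 0 < ‖h‖ := norm_pos_iff.mpr hne
      have hsum := hAz z hz (‖h‖⁻¹ • h) (by simp [norm_smul, hn.ne'])
      have hcard : ((Finset.univ.filter fun q => r * ‖h‖ < |inner ℝ h (z q)|).card : ℝ) ≤
          ∑ q, bump r (inner ℝ (‖h‖⁻¹ • h) (z q)) := by
        rw [Finset.card_filter, Nat.cast_sum]
        refine Finset.sum_le_sum fun q _ => ?_
        split_ifs with hq
        · rw [bump_eq_one hr, Nat.cast_one]
          rw [real_inner_smul_left, abs_mul, abs_of_pos (inv_pos.mpr hn), inv_mul_eq_div,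
            le_div_iff₀ hn]
          exact hq.le
        · simpa using bump_nonneg _ _
      -- The slack between 7/12 and 1 makes the inequality strict.
      linarith

end


/-! ### Robustness of the median -/

open Classical in
/-- If fewer than half of the values exceed `r` in absolute value, so does not the median. -/
lemma abs_median_le_of_card {Q : ℕ} (z : Fin Q → ℝ) {r : ℝ}
    (h : 2 * (Finset.univ.filter fun q => r < |z q|).card < Q) : |median z| ≤ r := by
  have hQ : 0 < Q := by omega
  set σ := Tuple.sort z with hσ
  have hmono : Monotone (z ∘ σ) := Tuple.monotone_sort z
  set i : Fin Q := ⟨(Q - 1) / 2, by omega⟩ with hi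
  set j : Fin Q := ⟨Q / 2, by omega⟩ with hj
  -- Otherwise all Q − ⌊Q/2⌋ values from the upper middle one on exceed r, which is at least half of
  -- them. Likewise ⌊(Q − 1)/2⌋ + 1 values lie at or below the lower middle one.
  have hup : z (σ j) ≤ r := by
    by_contra! hlt
    have hsub : (Finset.Ici j).map σ.toEmbedding ⊆ Finset.univ.filter fun q => r < |z q| := by
      intro q hq
      simp only [Finset.mem_map, Finset.mem_Ici] at hq
      obtain ⟨k, hk, rfl⟩ := hq
      simpa using lt_of_lt_of_le (hlt.trans_le (hmono hk)) (le_abs_self _)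
    have := Finset.card_le_card hsub
    rw [Finset.card_map, Fin.card_Ici] at this
    simp only [hj] at this
    omega
  have hlow : -r ≤ z (σ i) := by
    by_contra! hlt
    have hsub : (Finset.Iic i).map σ.toEmbedding ⊆ Finset.univ.filter fun q => r < |z q| := by
      intro q hq
      simp only [Finset.mem_map, Finset.mem_Iic] at hq
      obtain ⟨k, hk, rfl⟩ := hq
      have h1 : z (σ k) ≤ z (σ i) := hmono hk
      simpa using lt_of_lt_of_le (by linarith : r < -z (σ k)) (neg_le_abs _)
    have := Finset.card_le_card hsub
    rw [Finset.card_map, Fin.card_Iic] at this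
    simp only [hi] at this
    omega
  have hij : z (σ i) ≤ z (σ j) := hmono (by simp [hi, hj, Fin.le_def]; omega)
  rw [median, dif_pos hQ, abs_le]
  constructor <;> linarith

lemma IsBlockPartition.card_pos {N Q : ℕ} {S : Fin Q → Finset (Fin N)} (hS : IsBlockPartition S)
    (hN : 0 < N) (q : Fin Q) : 0 < (S q).card := by
  refine Nat.pos_of_ne_zero fun h => ?_
  have := hS.card_mul q
  rw [h, zero_mul] at this
  omega

open Classical in
-- Sending each corrupted index to its block covers all the blocks that contain one.
lemma IsBlockPartition.card_corrupted_le {N Q : ℕ} {S : Fin Q → Finset (Fin N)}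
    (hS : IsBlockPartition S) (D : Set (Fin N)) :
    (Finset.univ.filter fun q => ∃ n ∈ S q, n ∈ D).card ≤ D.ncard := by
  choose b hb using hS.cover
  rw [Set.ncard_eq_toFinset_card']
  refine (Finset.card_le_card fun q hq => ?_).trans (Finset.card_image_le (f := b))
  obtain ⟨n, hn, hnD⟩ : ∃ n ∈ S q, n ∈ D := by simpa using hq
  refine Finset.mem_image.mpr ⟨n, by simpa using hnD, ?_⟩
  by_contra hne
  exact Finset.disjoint_left.mp (hS.disjoint _ _ hne) (hb n) hn

/-! ### From the median bound to the minmax estimator -/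

section Estimator

variable {X : Type*} {H : Type*} [NormedAddCommGroup H] [InnerProductSpace ℝ H] [CompleteSpace H]
  [RKHS ℝ H X ℝ]

/-- The average of the features over a block, centred at `μ`. -/
noncomputable def centredBlockFeature {N : ℕ} (μ : H) (B : Finset (Fin N)) (y : Fin N → X) : H :=
  (B.card : ℝ)⁻¹ • ∑ n ∈ B, (feature H (y n) - μ)

lemma median_add_const {Q : ℕ} (hQ : 0 < Q) (z : Fin Q → ℝ) (c : ℝ) :
    median (fun q => z q + c) = median z + c := by
  have h1 := median_sub_mul hQ z (-2 * c)
  have h2 := median_sub_mul hQ (fun q => z q + c) 0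
  have : (fun q => -2 * c - 2 * z q) = fun q => 0 - 2 * (z q + c) := by ext; ring
  rw [this, h2] at h1
  linarith

/-- Centring at μ confines the data to one median of linear functionals of f − g; the rest is a
deterministic quadratic. -/
lemma criterion_eq_centred {N Q : ℕ} (hQ : 0 < Q) (S : Fin Q → Finset (Fin N))
    (hS : ∀ q, (S q).Nonempty) (y : Fin N → X) (f g μ : H) :
    criterion S y f g = 2 * inner ℝ (f - μ) (f - g) - ‖f - g‖ ^ 2 - 2 * median fun q =>
      inner ℝ (f - g) (centredBlockFeature μ (S q) y) := by
  have h : (fun q => inner ℝ (((S q).card : ℝ)⁻¹ • ∑ n ∈ S q, feature H (y n)) (f - g)) =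
      fun q => inner ℝ (f - g) (centredBlockFeature μ (S q) y) + inner ℝ μ (f - g) := by
    ext q
    have hc : ((S q).card : ℝ) ≠ 0 := by exact_mod_cast (hS q).card_pos.ne'
    rw [centredBlockFeature, Finset.sum_sub_distrib, Finset.sum_const, ← Nat.cast_smul_eq_nsmul ℝ,
      smul_sub, inv_smul_smul₀ hc, real_inner_comm, inner_sub_right, real_inner_comm (f - g) μ]
    ring
  rw [criterion_eq hQ S hS, h, median_add_const hQ, inner_sub_left f μ]
  ring

/-- Uniform control of the median of means yields the error bound for minmax estimators. -/
lemma norm_sub_le_of_mem_estimators {N Q : ℕ} (hQ : 0 < Q) (S : Fin Q → Finset (Fin N))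
    (hS : ∀ q, (S q).Nonempty) (y : Fin N → X) (μ : H) {r : ℝ} (hr : 0 ≤ r)
    (hmed : ∀ h : H, |median fun q => inner ℝ h (centredBlockFeature μ (S q) y)| ≤ r * ‖h‖)
    {f : H} (hf : f ∈ estimators H S y) : ‖f - μ‖ ≤ (1 + √2) * r := by
  -- With t = ‖μ − g‖ the criterion is at most 2rt − t² ≤ r².
  have hμ : (⨆ g : H, ((criterion S y μ g : ℝ) : EReal)) ≤ ((r ^ 2 : ℝ) : EReal) := by
    refine iSup_le fun g => EReal.coe_le_coe_iff.mpr ?_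
    rw [criterion_eq_centred hQ S hS y μ g μ, sub_self, inner_zero_left]
    have := (abs_le.mp (hmed (μ - g))).1
    nlinarith [sq_nonneg (‖μ - g‖ - r)]
  have hfμ : ((criterion S y f μ : ℝ) : EReal) ≤ ((r ^ 2 : ℝ) : EReal) :=
    (le_iSup (fun g : H => ((criterion S y f g : ℝ) : EReal)) μ).trans
      ((hf (Set.mem_univ μ)).trans hμ)
  rw [EReal.coe_le_coe_iff, criterion_eq_centred hQ S hS y f μ μ, real_inner_self_eq_norm_sq]
    at hfμ
  have h1 := (abs_le.mp (hmed (f - μ))).2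
  -- This is t² − 2rt ≤ r² with the square completed, for t = ‖f − μ‖.
  have h2 : (‖f - μ‖ - r) ^ 2 ≤ (√2 * r) ^ 2 := by
    rw [mul_pow, Real.sq_sqrt zero_le_two]
    nlinarith
  have := (abs_le_of_sq_le_sq' h2 (by positivity)).2
  linarith

open Classical in
/-- The median is robust to corruption: a block spoils it only if it is bad for the clean sample
or contains a corrupted point. -/
lemma abs_median_le_of_corruption {N Q : ℕ} {S : Fin Q → Finset (Fin N)}
    (hS : IsBlockPartition S) {x y : Fin N → X} {Nc : ℕ} (hy : {n | y n ≠ x n}.ncard ≤ Nc)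
    {δ : ℝ} (hNc : (Nc : ℝ) ≤ Q * (1 / 2 - δ)) (μ h : H) {ρ : ℝ}
    (hbad : ((Finset.univ.filter fun q =>
      ρ < |inner ℝ h (centredBlockFeature μ (S q) x)|).card : ℝ) < δ * Q) :
    |median fun q => inner ℝ h (centredBlockFeature μ (S q) y)| ≤ ρ := by
  refine abs_median_le_of_card _ ?_
  set D : Set (Fin N) := {n | y n ≠ x n} with hD
  have hsub : (Finset.univ.filter fun q => ρ < |inner ℝ h (centredBlockFeature μ (S q) y)|) ⊆
      (Finset.univ.filter fun q => ∃ n ∈ S q, n ∈ D) ∪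
        Finset.univ.filter fun q => ρ < |inner ℝ h (centredBlockFeature μ (S q) x)| := by
    intro q hq
    simp only [Finset.mem_union, Finset.mem_filter, Finset.mem_univ, true_and] at hq ⊢
    by_cases hc : ∃ n ∈ S q, n ∈ D
    · exact Or.inl hc
    · refine Or.inr ?_
      push Not at hc
      have : centredBlockFeature μ (S q) y = centredBlockFeature μ (S q) x := by
        unfold centredBlockFeature
        congr 1
        refine Finset.sum_congr rfl fun n hn => ?_
        have := hc n hn
        simp only [hD, Set.mem_ofPred_eq, ne_eq, not_not] at this
        rw [this]
      rwa [← this]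
  have h1 := (Finset.card_le_card hsub).trans (Finset.card_union_le _ _)
  have h2 : (Finset.univ.filter fun q => ∃ n ∈ S q, n ∈ D).card ≤ Nc := by
    refine le_trans (le_of_eq ?_) ((hS.card_corrupted_le D).trans hy)
    congr
  have h3 : ((Finset.univ.filter fun q =>
      ρ < |inner ℝ h (centredBlockFeature μ (S q) y)|).card : ℝ) ≤ Nc +
      (Finset.univ.filter fun q => ρ < |inner ℝ h (centredBlockFeature μ (S q) x)|).card := by
    exact_mod_cast h1.trans (Nat.add_le_add_right h2 _)
  -- Nc plus the clean bad blocks is less than Q(1/2 − δ) + δQ = Q/2.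
  have h4 : ((2 * (Finset.univ.filter fun q =>
      ρ < |inner ℝ h (centredBlockFeature μ (S q) y)|).card : ℕ) : ℝ) < Q := by
    push_cast
    linarith
  exact_mod_cast h4

end Estimator


/-! ### Independence of disjoint blocks -/

section IndependentBlocks

variable {Ω : Type*} [MeasurableSpace Ω] {P : Measure Ω} {E : Type*} [MeasurableSpace E]

/-- A family of independent random variables indexed by pairs splits into independent families. -/
lemma iIndepFun_curry {ι : Type*} {κ : ι → Type*} {X : (i : ι) → (j : κ i) → Ω → E}
    (mX : ∀ i j, Measurable (X i j))
    (h : iIndepFun (fun (p : (i : ι) × κ i) ω => X p.1 p.2 ω) P) :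
    iIndepFun (fun i ω => (X i · ω)) P := by
  have := h.isProbabilityMeasure
  have : ∀ i j, IsProbabilityMeasure (P.map (X i j)) :=
    fun i j => Measure.isProbabilityMeasure_map (mX i j).aemeasurable
  have hcurry : (MeasurableEquiv.piCurry fun (i : ι) (_ : κ i) => E) ∘
      (fun ω p => X p.1 p.2 ω) = fun ω i j => X i j ω := by
    ext; simp [Sigma.curry]
  have hi : ∀ i, iIndepFun (X i) P := fun i =>
    h.precomp (g := fun j : κ i => (⟨i, j⟩ : (i : ι) × κ i)) sigma_mk_injective
  -- Independence means that the joint law is a product, and currying turns a product over pairs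
  -- into an iterated product.
  rw [iIndepFun_iff_map_fun_eq_infinitePi_map (by fun_prop), ← hcurry,
    ← Measure.map_map (by fun_prop) (by fun_prop),
    (iIndepFun_iff_map_fun_eq_infinitePi_map (by fun_prop)).1 h,
    Measure.infinitePi_map_piCurry (fun i j => P.map (X i j))]
  congrm Measure.infinitePi fun i => ?_
  rw [(iIndepFun_iff_map_fun_eq_infinitePi_map (by fun_prop)).1 (hi i)]

/-- Disjointness makes (q, n) ↦ n injective on the pairs with n ∈ S q, so independence can be
reindexed by pairs and grouped by q. -/
lemma iIndepFun_sum_of_disjoint {N Q : ℕ} {V : Type*} [AddCommMonoid V] [MeasurableSpace V]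
    [MeasurableAdd₂ V] {v : Fin N → Ω → V} (hv : ∀ n, Measurable (v n)) (h : iIndepFun v P)
    {S : Fin Q → Finset (Fin N)} (hS : ∀ p q, p ≠ q → Disjoint (S p) (S q)) :
    iIndepFun (fun q ω => ∑ n ∈ S q, v n ω) P := by
  have hinj : Function.Injective fun p : (q : Fin Q) × S q => (p.2 : Fin N) := by
    rintro ⟨p, m⟩ ⟨q, n⟩ hmn
    simp only at hmn
    by_cases hpq : p = q
    · subst hpq
      rw [Subtype.ext hmn]
    · exact absurd (hmn ▸ n.2) (Finset.disjoint_left.mp (hS p q hpq) m.2)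
  have h1 := iIndepFun_curry (κ := fun q => S q) (X := fun q n => v n) (fun q n => hv n)
    (h.precomp hinj)
  have h2 := h1.comp (fun q (w : S q → V) => ∑ n, w n)
    fun q => Finset.measurable_sum _ fun n _ => measurable_pi_apply n
  convert h2 using 2 with q
  ext ω
  exact (Finset.sum_coe_sort (S q) fun n => v n ω).symm

end IndependentBlocks

/-! ### Second moments of Hilbert-valued variables -/

section Moments

variable {H : Type*} [NormedAddCommGroup H] [InnerProductSpace ℝ H]
  {Ω : Type*} [MeasurableSpace Ω] {μ : Measure Ω}

/-- Distinct orthonormal vectors are √2 apart, so the balls of radius 1/2 around them are disjoint.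
Countability allows sums over the basis to be exchanged with integrals. -/
lemma _root_.Orthonormal.countable_of_separableSpace [TopologicalSpace.SeparableSpace H]
    {ι : Type*} {v : ι → H} (hv : Orthonormal ℝ v) : Countable ι := by
  have hdisj : (Set.univ : Set ι).PairwiseDisjoint fun i => Metric.ball (v i) (1 / 2) := by
    intro i _ j _ hij
    refine Metric.ball_disjoint_ball ?_
    have h : ‖v i - v j‖ ^ 2 = 2 := by
      rw [norm_sub_sq_real, hv.1 i, hv.1 j, hv.2 hij]
      norm_num
    rw [dist_eq_norm]
    nlinarith [norm_nonneg (v i - v j)]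
  exact Set.countable_univ_iff.mp (hdisj.countable_of_isOpen (fun i _ => Metric.isOpen_ball)
    fun i _ => ⟨v i, by simp⟩)

lemma _root_.HilbertBasis.hasSum_sq_inner {ι : Type*} (e : HilbertBasis ι ℝ H) (x : H) :
    HasSum (fun i => inner ℝ (e i) x ^ 2) (‖x‖ ^ 2) := by
  have h : (fun i => inner ℝ (e i) x ^ 2) = fun i => inner ℝ x (e i) * inner ℝ (e i) x := by
    ext i
    rw [sq, real_inner_comm x (e i)]
  rw [h, ← real_inner_self_eq_norm_sq]
  exact e.hasSum_inner_mul_inner x x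

/-- The second moment of a random vector, computed in an orthonormal basis. -/
lemma hasSum_integral_sq_inner {ι : Type*} [Countable ι] (e : HilbertBasis ι ℝ H) {Z : Ω → H}
    (hZ : MemLp Z 2 μ) :
    HasSum (fun i => ∫ ω, inner ℝ (e i) (Z ω) ^ 2 ∂μ) (∫ ω, ‖Z ω‖ ^ 2 ∂μ) := by
  have hi : ∀ i, Integrable (fun ω => inner ℝ (e i) (Z ω) ^ 2) μ := fun i =>
    (hZ.const_inner (e i)).integrable_sq
  -- Bessel's inequality bounds every finite partial sum by the second moment.
  have hsum : Summable fun i => ∫ ω, ‖inner ℝ (e i) (Z ω) ^ 2‖ ∂μ := by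
    refine summable_of_sum_le (c := ∫ ω, ‖Z ω‖ ^ 2 ∂μ)
      (fun i => integral_nonneg fun ω => norm_nonneg _) fun s => ?_
    rw [← integral_finsetSum _ fun i _ => (hi i).norm]
    refine integral_mono (integrable_finsetSum _ fun i _ => (hi i).norm)
      (hZ.integrable_norm_pow two_ne_zero) fun ω => ?_
    simp only [norm_pow]
    exact e.orthonormal.sum_inner_products_le (Z ω)
  have h := hasSum_integral_of_summable_integral_norm hi hsum
  simpa only [(e.hasSum_sq_inner _).tsum_eq] using h

/-- The second moment of a sum of centred independent variables. -/
lemma integral_sq_sum_of_iIndepFun [IsProbabilityMeasure μ] {κ : Type*} {f : κ → Ω → ℝ}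
    (hf : ∀ i, MemLp (f i) 2 μ) (h0 : ∀ i, ∫ ω, f i ω ∂μ = 0) (h : iIndepFun f μ) (s : Finset κ) :
    ∫ ω, (∑ i ∈ s, f i ω) ^ 2 ∂μ = ∑ i ∈ s, ∫ ω, f i ω ^ 2 ∂μ := by
  have hvar := IndepFun.variance_sum (s := s) (fun i _ => hf i)
    fun i _ j _ hij => h.indepFun hij
  have hfs : MemLp (∑ i ∈ s, f i) 2 μ := memLp_finsetSum' s fun i _ => hf i
  rw [variance_of_integral_eq_zero hfs.aemeasurable] at hvar
  · simp only [Finset.sum_apply] at hvar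
    rw [hvar]
    exact Finset.sum_congr rfl fun i _ => variance_of_integral_eq_zero (hf i).aemeasurable (h0 i)
  · simp only [Finset.sum_apply]
    rw [integral_finsetSum _ fun i _ => (hf i).integrable one_le_two]
    simp [h0]

end Moments

/-! ### Feature map and covariance operator -/

section Features

variable {X : Type*} {H : Type*} [NormedAddCommGroup H] [InnerProductSpace ℝ H] [CompleteSpace H]
  [RKHS ℝ H X ℝ] {K : X → X → ℝ}

lemma inner_feature (hKH : ∀ x y, RKHS.kernel H x y 1 = K x y) (x y : X) :
    inner ℝ (feature H y) (feature H x) = K x y := by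
  rw [feature, feature, ← RKHS.kernel_inner, hKH]
  simp

lemma norm_feature_sq (hKH : ∀ x y, RKHS.kernel H x y 1 = K x y) (x : X) :
    ‖feature H x‖ ^ 2 = K x x := by
  rw [← real_inner_self_eq_norm_sq, inner_feature hKH]

/-- The squared distance of two features is K(y, y) − 2K(x, y) + K(x, x), which tends to 0 as y → x.
-/
lemma continuous_feature [TopologicalSpace X] (hK : Continuous fun p : X × X => K p.1 p.2)
    (hKH : ∀ x y, RKHS.kernel H x y 1 = K x y) : Continuous (feature H : X → H) := by
  refine continuous_iff_continuousAt.mpr fun x => ?_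
  rw [ContinuousAt, tendsto_iff_norm_sub_tendsto_zero]
  have h : ∀ y, ‖feature H y - feature H x‖ = √(K y y - 2 * K x y + K x x) := fun y => by
    rw [← Real.sqrt_sq (norm_nonneg (feature H y - feature H x)), norm_sub_sq_real,
      norm_feature_sq hKH, norm_feature_sq hKH, inner_feature hKH]
  have h1 : Continuous fun y => K y y := hK.comp (continuous_id.prodMk continuous_id)
  have h2 : Continuous fun y => K x y := hK.comp (continuous_const.prodMk continuous_id)
  have hc : Continuous fun y => √(K y y - 2 * K x y + K x x) := by fun_prop
  simp only [h]
  convert hc.tendsto x using 2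
  rw [show K x x - 2 * K x x + K x x = 0 by ring, Real.sqrt_zero]

/-- The features have separable range and span a dense subspace. Separability supplies the dense
directions and the measurability of sums in H. -/
lemma separableSpace_of_continuous_feature [TopologicalSpace X]
    [TopologicalSpace.SeparableSpace X] (hc : Continuous (feature H : X → H)) :
    TopologicalSpace.SeparableSpace H := by
  have hs := ((TopologicalSpace.isSeparable_range hc).span (R := ℝ)).closure
  refine TopologicalSpace.isSeparable_univ_iff.mp (hs.mono ?_)
  have hd := RKHS.kerFun_dense (𝕜 := ℝ) H (X := X) (V := ℝ)
  intro f _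
  have hf : f ∈ (Submodule.span ℝ
      {g : H | ∃ (x : X) (v : ℝ), RKHS.kerFun H x v = g}).topologicalClosure := by
    rw [hd]; trivial
  refine closure_mono ?_ hf
  refine Submodule.span_le.mpr ?_
  rintro _ ⟨x, v, rfl⟩
  have : RKHS.kerFun H x v = v • feature H x := by
    rw [feature, ← map_smul, smul_eq_mul, mul_one]
  rw [this]
  exact Submodule.smul_mem _ _ (Submodule.subset_span ⟨x, rfl⟩)

variable [MeasurableSpace X] {P : Measure X}

lemma inner_covOp_self_le (h : H) (hh : ‖h‖ ≤ 1) :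
    inner ℝ (covOp H P h) h ≤ ‖covOp H P‖ := by
  calc inner ℝ (covOp H P h) h ≤ ‖covOp H P h‖ * ‖h‖ := real_inner_le_norm _ _
    _ ≤ (‖covOp H P‖ * ‖h‖) * ‖h‖ := by gcongr; exact (covOp H P).le_opNorm h
    _ ≤ ‖covOp H P‖ := by
      rw [mul_assoc]
      exact mul_le_of_le_one_right (norm_nonneg _) (mul_le_one₀ hh (norm_nonneg _) hh)

variable [IsProbabilityMeasure P]

lemma integral_feature_sub_meanEmbedding (hf : MemLp (feature H : X → H) 2 P) :
    ∫ x, (feature H x - meanEmbedding H P) ∂P = 0 := by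
  rw [integral_sub (hf.integrable one_le_two) (integrable_const _)]
  simp [meanEmbedding]

lemma inner_covOp_self (hf : MemLp (feature H : X → H) 2 P) (h : H) :
    inner ℝ (covOp H P h) h = ∫ x, inner ℝ h (feature H x - meanEmbedding H P) ^ 2 ∂P := by
  have hZ : MemLp (fun x => feature H x - meanEmbedding H P) 2 P := hf.sub (memLp_const _)
  have hcont : Continuous fun z : H => (rankOne ℝ z z : H →L[ℝ] H) :=
    (rankOne ℝ).continuous.clm_apply continuous_id
  -- The norm of z ⊗ z is ‖z‖², so square integrability suffices. Without integrability the Bochner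
  -- integral in `covOp` would take its default value 0.
  have hi : Integrable (fun x => (rankOne ℝ (feature H x - meanEmbedding H P)
      (feature H x - meanEmbedding H P) : H →L[ℝ] H)) P := by
    refine (hZ.integrable_norm_pow two_ne_zero).mono'
      (hcont.comp_aestronglyMeasurable hZ.aestronglyMeasurable)
      (Filter.Eventually.of_forall fun x => ?_)
    rw [norm_rankOne, sq]
  rw [covOp, ContinuousLinearMap.integral_apply hi, real_inner_comm,
    ← integral_inner (hi.apply_continuousLinearMap h)]
  refine integral_congr_ae (Filter.Eventually.of_forall fun x => ?_)
  simp only [rankOne_apply, real_inner_smul_right]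
  rw [real_inner_comm h, sq]

lemma opTrace_covOp_nonneg {ι : Type*} (e : HilbertBasis ι ℝ H)
    (hf : MemLp (feature H : X → H) 2 P) : 0 ≤ opTrace e (covOp H P) :=
  tsum_nonneg fun i => by
    rw [inner_covOp_self hf]
    exact integral_nonneg fun x => sq_nonneg _

end Features

/-! ### Moments and independence of block averages -/

section BlockMoments

variable {X : Type*} [MeasurableSpace X] {H : Type*} [NormedAddCommGroup H]
  [InnerProductSpace ℝ H] [CompleteSpace H] [RKHS ℝ H X ℝ] {P : Measure X}
  {Ω : Type*} [MeasurableSpace Ω] {Pr : Measure Ω} {N : ℕ} {x : Fin N → Ω → X}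

section Integrability

variable [IsProbabilityMeasure Pr]

lemma memLp_feature_sub (hf : MemLp (feature H : X → H) 2 P) (hx : ∀ n, Measurable (x n))
    (hlaw : ∀ n, Pr.map (x n) = P) (μ : H) (n : Fin N) :
    MemLp (fun ω => feature H (x n ω) - μ) 2 Pr := by
  rw [← hlaw n] at hf
  exact (hf.comp_of_map (hx n).aemeasurable).sub (memLp_const _)

lemma memLp_centredBlockFeature (hf : MemLp (feature H : X → H) 2 P) (hx : ∀ n, Measurable (x n))
    (hlaw : ∀ n, Pr.map (x n) = P) (μ : H) (B : Finset (Fin N)) :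
    MemLp (fun ω => centredBlockFeature μ B fun n => x n ω) 2 Pr :=
  (memLp_finsetSum _ fun n _ => memLp_feature_sub hf hx hlaw μ n).const_smul _

end Integrability

variable [MeasurableSpace H] [BorelSpace H] [SecondCountableTopology H]

lemma measurable_centredBlockFeature (hfm : Measurable (feature H : X → H))
    (hx : ∀ n, Measurable (x n)) (μ : H) (B : Finset (Fin N)) :
    Measurable fun ω => centredBlockFeature μ B fun n => x n ω :=
  (Finset.measurable_sum _ fun n _ => (hfm.comp (hx n)).sub_const _).const_smul _

lemma iIndepFun_centredBlockFeature (hfm : Measurable (feature H : X → H))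
    (hx : ∀ n, Measurable (x n)) (hindep : iIndepFun x Pr) (μ : H) {Q : ℕ}
    {S : Fin Q → Finset (Fin N)} (hS : ∀ p q, p ≠ q → Disjoint (S p) (S q)) :
    iIndepFun (fun q ω => centredBlockFeature μ (S q) fun n => x n ω) Pr := by
  have h1 : iIndepFun (fun n ω => feature H (x n ω) - μ) Pr :=
    hindep.comp (fun _ a => feature H a - μ) fun _ => hfm.sub_const _
  exact (iIndepFun_sum_of_disjoint (fun n => (hfm.comp (hx n)).sub_const _) h1 hS).comp
    (fun q (w : H) => ((S q).card : ℝ)⁻¹ • w) fun q => measurable_const_smul _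

variable [IsProbabilityMeasure P] [IsProbabilityMeasure Pr]

/-- The covariance of a block average. -/
lemma integral_sq_inner_centredBlockFeature (hf : MemLp (feature H : X → H) 2 P)
    (hfm : Measurable (feature H : X → H))
    (hx : ∀ n, Measurable (x n)) (hlaw : ∀ n, Pr.map (x n) = P) (hindep : iIndepFun x Pr)
    {B : Finset (Fin N)} (hB : 0 < B.card) (h : H) :
    ∫ ω, inner ℝ h (centredBlockFeature (meanEmbedding H P) B fun n => x n ω) ^ 2 ∂Pr =
      inner ℝ (covOp H P h) h / B.card := by
  set f : Fin N → Ω → ℝ := fun n ω => inner ℝ h (feature H (x n ω) - meanEmbedding H P)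
  have hfn : ∀ n, MemLp (f n) 2 Pr := fun n =>
    (memLp_feature_sub hf hx hlaw _ n).const_inner h
  have hg : Measurable fun a => inner ℝ h (feature H a - meanEmbedding H P) := by fun_prop
  have htransfer : ∀ (n : Fin N) (φ : ℝ → ℝ), Measurable φ → ∫ ω, φ (f n ω) ∂Pr =
      ∫ a, φ (inner ℝ h (feature H a - meanEmbedding H P)) ∂P := fun n φ hφ => by
    have := integral_map (μ := Pr) (hx n).aemeasurable (hφ.comp hg).aestronglyMeasurable
    rw [hlaw n] at this
    exact this.symm
  have h0 : ∀ n, ∫ ω, f n ω ∂Pr = 0 := fun n => by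
    have hi : Integrable (fun a => feature H a - meanEmbedding H P) P :=
      (hf.sub (memLp_const _)).integrable one_le_two
    rw [htransfer n (fun t => t) measurable_id, integral_inner hi h,
      integral_feature_sub_meanEmbedding hf, inner_zero_right]
  have h2 : ∀ n, ∫ ω, f n ω ^ 2 ∂Pr = inner ℝ (covOp H P h) h := fun n => by
    rw [htransfer n (fun t => t ^ 2) (by fun_prop), inner_covOp_self hf]
  have hind : iIndepFun f Pr := hindep.comp (fun _ a => inner ℝ h (feature H a - meanEmbedding H P))
    fun _ => hg
  have hsum := integral_sq_sum_of_iIndepFun hfn h0 hind B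
  simp only [h2, Finset.sum_const, nsmul_eq_mul] at hsum
  have hBc : (B.card : ℝ) ≠ 0 := by exact_mod_cast hB.ne'
  simp only [centredBlockFeature, real_inner_smul_right, inner_sum, mul_pow, integral_const_mul]
  rw [hsum]
  field_simp

/-- The second moment of a block average is governed by the trace of the covariance. -/
lemma integral_norm_sq_centredBlockFeature {ι : Type*} (e : HilbertBasis ι ℝ H)
    (hf : MemLp (feature H : X → H) 2 P) (hfm : Measurable (feature H : X → H))
    (hx : ∀ n, Measurable (x n)) (hlaw : ∀ n, Pr.map (x n) = P) (hindep : iIndepFun x Pr)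
    {B : Finset (Fin N)} (hB : 0 < B.card) :
    ∫ ω, ‖centredBlockFeature (meanEmbedding H P) B fun n => x n ω‖ ^ 2 ∂Pr =
      opTrace e (covOp H P) / B.card := by
  have := e.orthonormal.countable_of_separableSpace
  rw [← (hasSum_integral_sq_inner e (memLp_centredBlockFeature hf hx hlaw _ B)).tsum_eq]
  simp only [integral_sq_inner_centredBlockFeature hf hfm hx hlaw hindep hB, tsum_div_const,
    opTrace]

end BlockMoments

end Monk

/-! ### The risk bound -/

theorem theorem1
    -- the domain, the kernel and its reproducing kernel Hilbert space
    {X : Type*} [TopologicalSpace X] [TopologicalSpace.SeparableSpace X]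
    [MeasurableSpace X] [BorelSpace X]
    (K : X → X → ℝ) (hK : Continuous fun p : X × X => K p.1 p.2)
    {H : Type*} [NormedAddCommGroup H] [InnerProductSpace ℝ H] [CompleteSpace H] [RKHS ℝ H X ℝ]
    (hKH : ∀ x y, RKHS.kernel H x y 1 = K x y)
    {ι : Type*} (e : HilbertBasis ι ℝ H)
    -- the law, for which the covariance operator exists and is trace-class
    (P : Measure X) [IsProbabilityMeasure P]
    (hP : Integrable (fun x => K x x) P)
    (hTr : Monk.IsTraceClass e (Monk.covOp H P))
    -- the clean i.i.d. sample `x` and the observed sample `y`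
    {Ω : Type*} [MeasurableSpace Ω] (Pr : Measure Ω) [IsProbabilityMeasure Pr]
    (N : ℕ) (x : Fin N → Ω → X) (hx : ∀ n, Measurable (x n))
    (hlaw : ∀ n, Pr.map (x n) = P) (hindep : iIndepFun x Pr)
    (y : Fin N → Ω → X) (Nc : ℕ) (hy : ∀ ω, {n | y n ω ≠ x n ω}.ncard ≤ Nc)
    -- the parameters and the blocks
    (δ η : ℝ) (hδ : δ ∈ Set.Ioc (0 : ℝ) (1 / 2)) (hη : η ∈ Set.Ioo (0 : ℝ) 1)
    (Q : ℕ) (hQ : (Q : ℝ) = 72 * (δ ^ 2)⁻¹ * Real.log (1 / η))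
    (hNc : (Nc : ℝ) ≤ Q * (1 / 2 - δ)) (hQN : (Q : ℝ) < N / 2)
    (S : Fin Q → Finset (Fin N)) (hS : Monk.IsBlockPartition S) :
    ∃ A : Set Ω, MeasurableSet A ∧ ENNReal.ofReal (1 - η) ≤ Pr A ∧
      ∀ ω ∈ A, ∀ f ∈ Monk.estimators H S (fun n => y n ω),
        ‖f - Monk.meanEmbedding H P‖ ≤
          12 * (1 + √2) / δ *
            max (√(6 * ‖Monk.covOp H P‖ * Real.log (1 / η) / (δ * N)))
              (2 * √(Monk.opTrace e (Monk.covOp H P) / N)) := by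
  classical
  obtain ⟨hδ0, -⟩ := hδ
  obtain ⟨hη0, hη1⟩ := hη
  have hlog : 0 < Real.log (1 / η) := Real.log_pos (by rw [lt_div_iff₀ hη0]; linarith)
  have hQ' : (0 : ℝ) < Q := by rw [hQ]; positivity
  have hQ0 : 0 < Q := by exact_mod_cast hQ'
  have hN' : (0 : ℝ) < N := by linarith
  have hN0 : 0 < N := by exact_mod_cast hN'
  have hlogQ : Real.log (1 / η) = Q * δ ^ 2 / 72 := by
    rw [hQ]
    field_simp
  have hηexp : Real.exp (-(Q * δ ^ 2 / 72)) = η := by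
    rw [← hlogQ, one_div, Real.log_inv, neg_neg, Real.exp_log hη0]
  have hSpos : ∀ q, 0 < (S q).card := hS.card_pos hN0
  have hcard : ∀ (q : Fin Q) (a : ℝ), a / (S q).card = a * Q / N := fun q a => by
    have h1 : ((S q).card : ℝ) * Q = N := by exact_mod_cast hS.card_mul q
    have h2 : (0 : ℝ) < (S q).card := by exact_mod_cast hSpos q
    rw [div_eq_div_iff h2.ne' hN'.ne', ← h1]
    ring
  have hcont := Monk.continuous_feature hK hKH
  let _ : MeasurableSpace H := borel H
  have : BorelSpace H := ⟨rfl⟩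
  have := Monk.separableSpace_of_continuous_feature hcont
  have : SecondCountableTopology H := UniformSpace.secondCountable_of_separable H
  have hfm : Measurable (Monk.feature H : X → H) := hcont.measurable
  have hf : MemLp (Monk.feature H : X → H) 2 P := by
    rw [memLp_two_iff_integrable_sq_norm hfm.aestronglyMeasurable]
    simpa only [Monk.norm_feature_sq hKH] using hP
  set μ := Monk.meanEmbedding H P with hμ
  set σ := ‖Monk.covOp H P‖ with hσ
  set τ := Monk.opTrace e (Monk.covOp H P) with hτ
  have hσ0 : 0 ≤ σ := norm_nonneg _
  have hτ0 : 0 ≤ τ := Monk.opTrace_covOp_nonneg e hf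
  set m := max (√(6 * σ * Real.log (1 / η) / (δ * N))) (2 * √(τ / N)) with hm
  have hm0 : 0 ≤ m := (Real.sqrt_nonneg _).trans (le_max_left _ _)
  have hm1 : 6 * σ * Real.log (1 / η) / (δ * N) ≤ m ^ 2 :=
    (Real.sqrt_le_left hm0).mp (le_max_left _ _)
  have hm2 : 4 * (τ / N) ≤ m ^ 2 := by
    have h1 : 2 * √(τ / N) ≤ m := le_max_right _ _
    have h2 := Real.sq_sqrt (div_nonneg hτ0 hN'.le)
    nlinarith [Real.sqrt_nonneg (τ / N)]
  -- Since the blocks have N/Q elements, their averages have variance at most σQ/N in unit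
  -- directions and second moment τQ/N. This r makes the two entries of the maximum m exactly the
  -- conditions `hs` and `hV`, given ln(1/η) = Qδ²/72.
  set r := 12 / δ * m with hr
  have hr0 : 0 ≤ r := by positivity
  have hs : 12 * (σ * Q / N) ≤ δ * r ^ 2 := by
    have h1 : δ * r ^ 2 = 144 / δ * m ^ 2 := by rw [hr]; field_simp; ring
    have h2 : 12 * (σ * Q / N) = 144 / δ * (6 * σ * Real.log (1 / η) / (δ * N)) := by
      rw [hlogQ]; field_simp; ring
    rw [h1, h2]
    gcongr
  have hV : 576 * (τ * Q / N) ≤ δ ^ 2 * r ^ 2 * Q := by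
    have h1 : δ ^ 2 * r ^ 2 * Q = 144 * Q * m ^ 2 := by rw [hr]; field_simp; ring
    have h2 : 576 * (τ * Q / N) = 144 * Q * (4 * (τ / N)) := by ring
    rw [h1, h2]
    gcongr
  set Z : Fin Q → Ω → H := fun q ω => Monk.centredBlockFeature μ (S q) fun n => x n ω with hZ
  have hZm : ∀ q, Measurable (Z q) := fun q => Monk.measurable_centredBlockFeature hfm hx μ (S q)
  have hZ2 : ∀ q, MemLp (Z q) 2 Pr := fun q =>
    Monk.memLp_centredBlockFeature hf hx hlaw μ (S q)
  have hZind : iIndepFun Z Pr := Monk.iIndepFun_centredBlockFeature hfm hx hindep μ hS.disjoint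
  have hprob : ∀ q, IsProbabilityMeasure (Pr.map (Z q)) := fun q =>
    Measure.isProbabilityMeasure_map (hZm q).aemeasurable
  obtain ⟨A, hA, hAp, hAz⟩ := Monk.exists_measurableSet_forall_card_lt hQ0
    (fun q => Pr.map (Z q))
    (fun q => (memLp_map_measure_iff aestronglyMeasurable_id (hZm q).aemeasurable).mpr (hZ2 q))
    hr0 hδ0 hs hV
    (fun q h hh => by
      have hg : Measurable fun z : H => inner ℝ h z ^ 2 := by fun_prop
      rw [integral_map (hZm q).aemeasurable hg.aestronglyMeasurable,
        Monk.integral_sq_inner_centredBlockFeature hf hfm hx hlaw hindep (hSpos q), hcard]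
      gcongr
      exact Monk.inner_covOp_self_le h hh)
    (fun q => by
      have hg : Measurable fun z : H => ‖z‖ ^ 2 := by fun_prop
      rw [integral_map (hZm q).aemeasurable hg.aestronglyMeasurable,
        Monk.integral_norm_sq_centredBlockFeature e hf hfm hx hlaw hindep (hSpos q), hcard])
  have hZpi : Measurable fun ω q => Z q ω := measurable_pi_lambda _ hZm
  -- The event involves only the clean sample, so it is measurable and serves every corruption,
  -- whether or not y is measurable in ω.
  refine ⟨(fun ω q => Z q ω) ⁻¹' A, hZpi hA, ?_, fun ω hω f hfe => ?_⟩
  · rw [← Measure.map_apply hZpi hA, hZind.map_fun_eq_pi_map fun q => (hZm q).aemeasurable]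
    rwa [hηexp] at hAp
  · have hbound := Monk.norm_sub_le_of_mem_estimators hQ0 S (fun q => Finset.card_pos.mp (hSpos q))
      (fun n => y n ω) μ hr0 (fun h => Monk.abs_median_le_of_corruption hS
        (x := fun n => x n ω) (hy ω) hNc μ h (by convert hAz _ hω h)) hfe
    refine hbound.trans (le_of_eq ?_)
    rw [hr]
    ring
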